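/- For a compact Hausdorff space $X$, let $C(X)=C(X,\mathbb{C})$ carry the supremum norm, and write $\mathcal{A}\le_a C(X)$ if $\mathcal{A}$ is a subalgebra of $C(X)$ that separates points and contains the constant functions. $X$ has the CSWP (complex Stone–Weierstrass property) if every $\mathcal{A}\le_a C(X)$ is dense in $C(X)$. $X$ has the NTIP if every closed $\mathcal{A}\le_a C(X)$ contains a non-trivial idempotent, i.e. a characteristic function $\chi_H$ with $\emptyset\subsetneq H\subsetneq X$. The kernel $\ker(X)$ is the largest closed subset of $X$ having no relatively isolated points (it is empty iff $X$ is scattered). There are compact Hausdorff totally disconnected spaces $X$ and $Y$ such that: 1. $X$ has the NTIP, but $\ker(X)$ does not have the NTIP. 2. $Y$ has the NTIP, but not the CSWP. More precisely, let $K\subset\mathbb{R}$ be the Cantor set. (a) Let $X$ be the Aleksandrov duplicate of $K$, i.e. $K\times\{0,1\}$ with the topology in which every point $(x,1)$ is isolated and the sets $(U\times\{0,1\})\setminus\{(x,1)\}$, with $U$ an open neighbourhood of $x$ in $K$, form a neighbourhood base at $(x,0)$. Then $X$ is compact, Hausdorff and totally disconnected, $X$ has the NTIP, $\ker(X)$ does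 not have the NTIP, and $X$ does not have the CSWP; so $X$ is as in (1), and $Y=X$ is as in (2). (b) Let $Y$ be the disjoint topological sum of $K$ and the double arrow space, where the double arrow space is $[0,1]\times\{0\}\,\cup\,(0,1)\times\{1\}$ with the order topology of the lexicographic order. Then $Y$ is compact, Hausdorff and totally disconnected, and has the NTIP but not the CSWP. -/

import Mathlib

open Set

/-- The complex Stone-Weierstrass property: every subalgebra of `C(X, ℂ)` that separates points
(a `Subalgebra ℂ` contains the constants) is dense in the sup-norm topology. It is only used for
compact Hausdorff `X`, where the topology of `C(X, ℂ)` is that of the sup norm. -/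
def HasCSWP (X : Type*) [TopologicalSpace X] : Prop :=
  ∀ A : Subalgebra ℂ C(X, ℂ), A.SeparatesPoints → Dense (A : Set C(X, ℂ))

/-- The NTIP: every closed subalgebra of `C(X, ℂ)` that separates points and contains the
constants contains a non-trivial idempotent, that is, the characteristic function of some `H` with
`∅ ⊊ H ⊊ X`. Such an `H` is automatically clopen. -/
def HasNTIP (X : Type*) [TopologicalSpace X] : Prop :=
  ∀ A : Subalgebra ℂ C(X, ℂ), A.SeparatesPoints → IsClosed (A : Set C(X, ℂ)) →
    ∃ f ∈ A, ∃ H : Set X, H.Nonempty ∧ H ≠ univ ∧ ∀ x, f x = H.indicator (fun _ => (1 : ℂ)) x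

/-- The kernel of a space: its largest closed subset without relatively isolated points
(which is empty exactly when the space is scattered). -/
def spaceKernel (X : Type*) [TopologicalSpace X] : Set X :=
  CantorBendixson.perfectKernel (univ : Set X)

/-- The kernel contains every closed subset without isolated points and is itself one.
(`Perfect` does not require non-emptiness.) -/
theorem isGreatest_spaceKernel (X : Type*) [TopologicalSpace X] :
    IsGreatest {P : Set X | Perfect P} (spaceKernel X) :=
  ⟨CantorBendixson.perfect_perfectKernel isClosed_univ,
    fun _ hP => hP.subset_perfectKernel (subset_univ _)⟩

/-- The Aleksandrov duplicate of `X`: two copies of `X`, where `(x, false)` stands for the point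
`x` of the original copy and `(x, true)` for its isolated twin. -/
def AleksandrovDuplicate (X : Type*) : Type _ := X × Bool

/-- Points `(x, true)` are isolated; the sets `(U × {false, true}) \ {(x, true)}`, with `U` an open
neighbourhood of `x`, form a neighbourhood base at `(x, false)`. -/
instance AleksandrovDuplicate.instTopologicalSpace (X : Type*) [TopologicalSpace X] :
    TopologicalSpace (AleksandrovDuplicate X) where
  IsOpen s := ∀ x : X, ((x, false) : X × Bool) ∈ s → ∃ U : Set X, IsOpen U ∧ x ∈ U ∧
    (U ×ˢ (univ : Set Bool)) \ {(x, true)} ⊆ s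
  isOpen_univ := fun _ _ => ⟨univ, isOpen_univ, mem_univ _, subset_univ _⟩
  isOpen_inter := by
    intro s t hs ht x hx
    obtain ⟨U, hU, hxU, hUs⟩ := hs x hx.1
    obtain ⟨V, hV, hxV, hVt⟩ := ht x hx.2
    exact ⟨U ∩ V, hU.inter hV, ⟨hxU, hxV⟩, fun p hp =>
      ⟨hUs ⟨⟨hp.1.1.1, mem_univ _⟩, hp.2⟩, hVt ⟨⟨hp.1.1.2, mem_univ _⟩, hp.2⟩⟩⟩
  isOpen_sUnion := by
    intro S hS x hx
    obtain ⟨s, hs, hxs⟩ := hx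
    obtain ⟨U, hU, hxU, hUs⟩ := hS s hs x hxs
    exact ⟨U, hU, hxU, fun p hp => ⟨s, hs, hUs hp⟩⟩

/-- The space `[0,1] × {0} ∪ E × {1}`, ordered lexicographically: the unit interval with the points
of `E` doubled (`false` plays the role of `0` and `true` of `1`). -/
def DoubledInterval (E : Set ℝ) : Type :=
  {p : ℝ ×ₗ Bool // ((ofLex p).1 ∈ Icc (0 : ℝ) 1 ∧ (ofLex p).2 = false) ∨
    ((ofLex p).1 ∈ E ∧ (ofLex p).2 = true)}

noncomputable instance DoubledInterval.instLinearOrder (E : Set ℝ) :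
    LinearOrder (DoubledInterval E) :=
  inferInstanceAs (LinearOrder {p : ℝ ×ₗ Bool // ((ofLex p).1 ∈ Icc (0 : ℝ) 1 ∧
    (ofLex p).2 = false) ∨ ((ofLex p).1 ∈ E ∧ (ofLex p).2 = true)})

/-- The order topology. -/
noncomputable instance DoubledInterval.instTopologicalSpace (E : Set ℝ) :
    TopologicalSpace (DoubledInterval E) :=
  Preorder.topology (DoubledInterval E)

instance DoubledInterval.instOrderTopology (E : Set ℝ) : OrderTopology (DoubledInterval E) :=
  ⟨rfl⟩

/-- The double arrow space: all points of the open interval `(0,1)` are doubled. -/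
abbrev DoubleArrow : Type := DoubledInterval (Ioo 0 1)

section

open Filter Topology MeasureTheory

/-! Both NTIP proofs rest on one criterion, `Subalgebra.exists_idempotent_of_re_ne`: a closed
algebra has a non-trivial idempotent as soon as the real part of some member omits a value `m`
strictly between two of its values. The Newton iteration for `z ^ 2 = 1`, started at that member
minus `m`, stays in the algebra and converges uniformly to a function with values `±1`.

The Cantor set fails the NTIP. It is homeomorphic to its square, which embeds in the plane as a
self-similar set of dimension `log 4 / log 3 > 1`, so the Cauchy transform of the natural measure
extends continuously to the plane. Hence the functions continuous on the Riemann sphere and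
holomorphic off the set separate its points. By the maximum principle restriction to the set is
isometric, so an idempotent in the closed restricted algebra comes from one on the connected sphere
and is constant. A closed copy of the Cantor set then excludes the CSWP: take all functions whose
restriction lies in this algebra.

In the duplicate, a member without idempotents around must attain its maximum modulus on the base
copy, because only finitely many twins can exceed the base values. The algebra thus embeds
isometrically in the separable `C(K)`. Each function distinguishes only countably many points from
their twins, so some twin is never separated from its base point.

In the sum, each `t` in `(0,1)` gives a member jumping from `0` to `1` at `t`. Up to a small error
and the position of its jumps, such a function is described by countably many data, so two of them
share a description. Their difference is small on `K`, close to `0` or plus or minus a jump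
elsewhere, and close to `±1` somewhere; its real part therefore omits a value. -/

/-! ### Idempotents from a gap in the real part -/

/-- Passing to a closed subalgebra enlarges the spectrum only by bounded components of its
complement. The imaginary axis misses the range of `f`, so the component of `0` is unbounded. -/
theorem Subalgebra.exists_mem_eq_inv {X : Type*} [TopologicalSpace X] [CompactSpace X]
    {A : Subalgebra ℂ C(X, ℂ)} (hA : IsClosed (A : Set C(X, ℂ))) {f : C(X, ℂ)} (hf : f ∈ A)
    (h : ∀ x, (f x).re ≠ 0) : ∃ g ∈ A, ∀ x, g x = (f x)⁻¹ := by
  have hU : IsUnit (⟨f, hf⟩ : A) := by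
    by_contra hn
    have h0 : (0 : ℂ) ∈ spectrum ℂ (⟨f, hf⟩ : A) := (spectrum.zero_mem_iff ℂ).2 hn
    have hb := Subalgebra.spectrum_isBounded_connectedComponentIn (hS := hA) A ⟨f, hf⟩ h0
    have hsub : range (fun t : ℝ => (t : ℂ) * Complex.I) ⊆
        connectedComponentIn (spectrum ℂ f)ᶜ 0 := by
      apply (isPreconnected_range (by fun_prop)).subset_connectedComponentIn ⟨0, by simp⟩
      rintro _ ⟨t, rfl⟩
      rw [ContinuousMap.spectrum_eq_range]
      rintro ⟨x, hx⟩
      exact h x (by simp [hx])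
    obtain ⟨C, hC⟩ := (hb.subset hsub).exists_norm_le
    have := hC _ ⟨|C| + 1, rfl⟩
    rw [norm_mul, Complex.norm_I, mul_one, Complex.norm_real, Real.norm_eq_abs] at this
    have h2 := le_abs_self (|C| + 1)
    have h3 := le_abs_self C
    linarith
  obtain ⟨u, hu⟩ := hU
  refine ⟨(↑u⁻¹ : A), (↑u⁻¹ : A).2, fun x => ?_⟩
  have h1 : ((u : A) * (↑u⁻¹ : A) : A) = 1 := u.mul_inv
  rw [hu] at h1
  have h2 := congrArg (fun a : A => (a : C(X, ℂ)) x) h1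
  exact eq_inv_of_mul_eq_one_right h2

/-- Newton's iteration for the equation `z ^ 2 = 1`. -/
noncomputable def signNewton (z : ℂ) : ℂ := (z + z⁻¹) / 2

theorem signNewton_neg (z : ℂ) : signNewton (-z) = -signNewton z := by
  simp only [signNewton, inv_neg]; ring

theorem signNewton_re_ne_zero {z : ℂ} (hz : z.re ≠ 0) : (signNewton z).re ≠ 0 := by
  have hz0 : z ≠ 0 := by rintro rfl; simp at hz
  have h1 : 0 < Complex.normSq z := Complex.normSq_pos.2 hz0
  have : (signNewton z).re = z.re * (1 + (Complex.normSq z)⁻¹) / 2 := by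
    simp [signNewton, Complex.inv_re]; ring
  rw [this]
  positivity

/-- The Cayley transform `w = (z - 1) / (z + 1)` conjugates the Newton map to squaring. -/
theorem signNewton_iterate_eq {w : ℂ} (hw : ‖w‖ < 1) (n : ℕ) :
    signNewton^[n] ((1 + w) / (1 - w)) = (1 + w ^ 2 ^ n) / (1 - w ^ 2 ^ n) := by
  induction n with
  | zero => simp
  | succ n ih =>
    rw [Function.iterate_succ_apply', ih, pow_succ 2 n, pow_mul]
    have hlt : ‖w ^ 2 ^ n‖ < 1 := by
      rw [norm_pow]; exact pow_lt_one₀ (norm_nonneg _) hw (by positivity)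
    generalize w ^ 2 ^ n = v at hlt
    have h1 : 1 - v ≠ 0 := fun h => by
      rw [← sub_eq_zero.1 h] at hlt; simp at hlt
    have h2 : 1 + v ≠ 0 := fun h => by
      rw [← neg_eq_of_add_eq_zero_right h] at hlt; simp at hlt
    have h3 : 1 - v ^ 2 ≠ 0 := by
      rw [show 1 - v ^ 2 = (1 - v) * (1 + v) by ring]; exact mul_ne_zero h1 h2
    rw [signNewton]
    field_simp
    ring

theorem norm_signNewton_iterate_sub_one_le {z : ℂ} {r : ℝ} (hr : r < 1) (hz : 0 < z.re)
    (h : ‖(z - 1) / (z + 1)‖ ≤ r) (n : ℕ) :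
    ‖signNewton^[n] z - 1‖ ≤ 2 * r ^ n / (1 - r) := by
  set w := (z - 1) / (z + 1) with hw
  have hz1 : z + 1 ≠ 0 := fun h => by
    have := congrArg Complex.re h; simp at this; linarith
  have hw1 : 1 - w ≠ 0 := by
    rw [hw, one_sub_div hz1]; apply div_ne_zero _ hz1; ring_nf; norm_num
  have hzw : z = (1 + w) / (1 - w) := by
    rw [eq_div_iff hw1, hw]; field_simp; ring
  have hr0 : 0 ≤ r := (norm_nonneg _).trans h
  rw [hzw, signNewton_iterate_eq (h.trans_lt hr)]
  -- The doubly exponential rate is weakened to a geometric one, which suffices for uniform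
  -- convergence.
  have hv : ‖w ^ 2 ^ n‖ ≤ r ^ n := by
    rw [norm_pow]
    exact (pow_le_pow_left₀ (norm_nonneg _) h _).trans
      (pow_le_pow_of_le_one hr0 hr.le Nat.lt_two_pow_self.le)
  have hv' : ‖w ^ 2 ^ n‖ ≤ r := by
    rw [norm_pow]
    exact (pow_le_pow_left₀ (norm_nonneg _) h _).trans
      (pow_le_of_le_one hr0 hr.le (by positivity))
  generalize w ^ 2 ^ n = v at hv hv'
  have h1 : 1 - r ≤ ‖1 - v‖ := by
    have := norm_sub_norm_le (1 : ℂ) v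
    rw [norm_one] at this; linarith
  have h0 : 0 < 1 - r := by linarith
  have h2 : 1 - v ≠ 0 := norm_pos_iff.1 (h0.trans_le h1)
  rw [show (1 + v) / (1 - v) - 1 = 2 * v / (1 - v) by field_simp; ring, norm_div, norm_mul,
    Complex.norm_two]
  gcongr

/-- A closed algebra containing a function whose real part omits a value strictly between two of its
values contains a non-trivial idempotent. -/
theorem Subalgebra.exists_idempotent_of_re_ne {X : Type*} [TopologicalSpace X] [CompactSpace X]
    {A : Subalgebra ℂ C(X, ℂ)} (hA : IsClosed (A : Set C(X, ℂ))) {f : C(X, ℂ)} (hf : f ∈ A)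
    {m : ℝ} (h : ∀ x, (f x).re ≠ m) {p q : X} (hp : (f p).re < m) (hq : m < (f q).re) :
    ∃ g ∈ A, ∃ H : Set X, H.Nonempty ∧ H ≠ univ ∧ ∀ x, g x = H.indicator (fun _ => (1 : ℂ)) x := by
  wlog hm : m = 0 generalizing f m
  · refine this (f := f - algebraMap ℂ _ (m : ℂ)) (m := 0) (A.sub_mem hf (A.algebraMap_mem _))
      (fun x => ?_) ?_ ?_ rfl
    · simpa [sub_eq_zero] using h x
    · simpa using hp
    · simpa using hq
  subst hm
  -- The sign of `Re f`, continuous because `Re f` never vanishes. It is the limit of the Newton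
  -- iterates, and `s * f` has values in the right half-plane.
  let s : C(X, ℂ) := ⟨fun x => (((f x).re / |(f x).re| : ℝ) : ℂ), by
    have hre : Continuous fun x => (f x).re := Complex.continuous_re.comp f.continuous
    exact Complex.continuous_ofReal.comp (hre.div hre.abs fun x => abs_ne_zero.2 (h x))⟩
  have hspos : ∀ x, 0 < (f x).re → s x = 1 := fun x hx => by
    simp [s, abs_of_pos hx, h x]
  have hsneg : ∀ x, (f x).re < 0 → s x = -1 := fun x hx => by
    simp [s, abs_of_neg hx, h x]
  have hu : ∀ x, 0 < (s x * f x).re := fun x => by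
    rcases lt_or_gt_of_ne (h x) with hx | hx
    · simp [hsneg x hx, hx]
    · simp [hspos x hx, hx]
  have hu1 : ∀ x, s x * f x + 1 ≠ 0 := fun x hx => by
    have := congrArg Complex.re hx
    rw [Complex.add_re] at this
    simp only [Complex.one_re, Complex.zero_re] at this
    linarith [hu x]
  -- The Cayley transform maps the right half-plane into the open unit disc; compactness gives one
  -- contraction ratio `r < 1` for all points.
  obtain ⟨x₀, -, hx₀⟩ := isCompact_univ.exists_isMaxOn ⟨p, mem_univ p⟩
    (f := fun x => ‖(s x * f x - 1) / (s x * f x + 1)‖)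
    (by
      apply Continuous.continuousOn
      refine Continuous.norm (Continuous.div ?_ ?_ hu1) <;> fun_prop)
  set r := ‖(s x₀ * f x₀ - 1) / (s x₀ * f x₀ + 1)‖ with hrdef
  have hr1 : r < 1 := by
    rw [hrdef, norm_div, div_lt_one (norm_pos_iff.2 (hu1 _)), Complex.norm_def, Complex.norm_def]
    apply Real.sqrt_lt_sqrt (Complex.normSq_nonneg _)
    simp only [Complex.normSq_apply, Complex.sub_re, Complex.add_re, Complex.sub_im,
      Complex.add_im, Complex.one_re, Complex.one_im]
    nlinarith [hu x₀]
  have hmem : ∀ n, ∃ g ∈ A, ∀ x, g x = signNewton^[n] (f x) ∧ (g x).re ≠ 0 := by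
    intro n
    induction n with
    | zero => exact ⟨f, hf, fun x => ⟨rfl, h x⟩⟩
    | succ n ih =>
      obtain ⟨g, hg, hgx⟩ := ih
      obtain ⟨k, hk, hkx⟩ := Subalgebra.exists_mem_eq_inv hA hg fun x => (hgx x).2
      refine ⟨(2⁻¹ : ℂ) • (g + k), A.smul_mem (A.add_mem hg hk) _, fun x => ?_⟩
      have : ((2⁻¹ : ℂ) • (g + k)) x = signNewton (g x) := by
        simp [hkx, signNewton]; ring
      rw [this]
      refine ⟨?_, signNewton_re_ne_zero (hgx x).2⟩
      rw [Function.iterate_succ_apply', (hgx x).1]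
  choose g hgA hgx using hmem
  have hlim : Tendsto g atTop (𝓝 s) := by
    rw [tendsto_iff_dist_tendsto_zero]
    have hr0 : 0 ≤ r := norm_nonneg _
    refine squeeze_zero (fun _ => dist_nonneg) (g := fun n => 2 * r ^ n / (1 - r)) (fun n => ?_) ?_
    · rw [ContinuousMap.dist_le (div_nonneg (by positivity) (by linarith))]
      intro x
      rw [(hgx n x).1, dist_eq_norm]
      have hx := norm_signNewton_iterate_sub_one_le hr1 (hu x) (hx₀ (mem_univ x)) n
      rcases lt_or_gt_of_ne (h x) with hx' | hx'
      · have hneg : signNewton^[n] (-f x) = -signNewton^[n] (f x) :=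
          ((show Function.Semiconj Neg.neg signNewton signNewton from
            fun z => (signNewton_neg z).symm).iterate_right n (f x)).symm
        rw [hsneg x hx', neg_one_mul, hneg] at hx
        rw [hsneg x hx', ← norm_neg, neg_sub', neg_neg]
        exact hx
      · rw [hspos x hx'] at hx ⊢
        rwa [one_mul] at hx
    · have := ((tendsto_pow_atTop_nhds_zero_of_lt_one hr0 hr1).const_mul 2).div_const (1 - r)
      simpa using this
  have hsA : s ∈ A := hA.mem_of_tendsto hlim (Eventually.of_forall hgA)
  refine ⟨(2⁻¹ : ℂ) • (1 + s), A.smul_mem (A.add_mem A.one_mem hsA) _, {x | 0 < (f x).re},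
    ⟨q, hq⟩, fun hH => ?_, fun x => ?_⟩
  · have : p ∈ {x | 0 < (f x).re} := hH ▸ mem_univ p
    exact lt_asymm hp this
  · rcases lt_or_gt_of_ne (h x) with hx | hx
    · rw [indicator_of_notMem (by simpa using hx.le)]
      simp [hsneg x hx]
    · rw [indicator_of_mem (by simpa using hx)]
      simp [hspos x hx]
      norm_num

/-! ### Holomorphic functions on the sphere off a compact set -/

/-- The algebra of continuous functions on the Riemann sphere that are holomorphic on the open set
`U` of finite points. -/
def sphereAlgebra (U : Set ℂ) : Subalgebra ℂ C(OnePoint ℂ, ℂ) where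
  carrier := {F | DifferentiableOn ℂ (fun z : ℂ => F z) U}
  mul_mem' := fun hF hG => DifferentiableOn.mul hF hG
  add_mem' := fun hF hG => DifferentiableOn.add hF hG
  algebraMap_mem' := fun _ => differentiableOn_const _

/-- The maximum principle on the Riemann sphere. -/
theorem exists_norm_le_of_mem_sphereAlgebra {K : Set ℂ} (hK : IsCompact K) (hne : K.Nonempty)
    {F : C(OnePoint ℂ, ℂ)} (hF : F ∈ sphereAlgebra Kᶜ) : ∃ w ∈ K, ∀ p, ‖F p‖ ≤ ‖F (w : OnePoint ℂ)‖ := by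
  obtain ⟨p₀, -, hp₀⟩ := isCompact_univ.exists_isMaxOn ⟨OnePoint.infty, mem_univ _⟩
    (f := fun p => ‖F p‖) (by fun_prop)
  by_contra! hcon
  -- If the maximum were not attained on `K`, this set would be clopen, non-empty and disjoint from
  -- `K`, against connectedness of the sphere.
  set Z : Set (OnePoint ℂ) := {p | ‖F p‖ = ‖F p₀‖} with hZ
  have hmax : ∀ p, ‖F p‖ ≤ ‖F p₀‖ := fun p => hp₀ (mem_univ p)
  have hZK : ∀ w ∈ K, (w : OnePoint ℂ) ∉ Z := fun w hw hwZ => by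
    obtain ⟨p, hp⟩ := hcon w hw
    rw [show ‖F w‖ = ‖F p₀‖ from hwZ] at hp
    exact absurd (hmax p) (not_le.2 hp)
  have hdiff : ∀ z ∉ K, ∀ᶠ y in 𝓝 z, DifferentiableAt ℂ (fun z : ℂ => F z) y := fun z hz =>
    (hK.isClosed.isOpen_compl.eventually_mem hz).mono fun y hy =>
      (hF y hy).differentiableAt (hK.isClosed.isOpen_compl.mem_nhds hy)
  have hopen : IsOpen Z := by
    rw [isOpen_iff_mem_nhds]
    intro p hp
    induction p using OnePoint.rec with
    | coe z =>
      have hzK : z ∉ K := fun h => hZK z h hp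
      have := Complex.norm_eventually_eq_of_isLocalMax (f := fun z : ℂ => F z) (c := z)
        (hdiff z hzK) (Eventually.of_forall fun y => by
          simp only [Function.comp]
          rw [show ‖F z‖ = ‖F p₀‖ from hp]; exact hmax _)
      rw [OnePoint.nhds_coe_eq, mem_map]
      filter_upwards [this] with y hy
      exact hy.trans hp
    | infty =>
      -- `F` in the chart `w = 1 / z` at infinity; the singularity at `0` is removable by
      -- continuity.
      let G : ℂ → ℂ := fun w => if w = 0 then F OnePoint.infty else F ((w⁻¹ : ℂ) : OnePoint ℂ)
      have htend : Tendsto (fun w : ℂ => (w⁻¹ : ℂ)) (𝓝[≠] 0) (coclosedCompact ℂ) := by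
        rw [coclosedCompact_eq_cocompact, ← Metric.cobounded_eq_cocompact]
        exact Filter.tendsto_inv₀_nhdsNE_zero
      have hcont : ContinuousAt G 0 := by
        rw [continuousAt_iff_punctured_nhds]
        have h1 : Tendsto (fun w : ℂ => F ((w⁻¹ : ℂ) : OnePoint ℂ)) (𝓝[≠] 0)
            (𝓝 (F OnePoint.infty)) :=
          (F.continuous.tendsto _).comp (OnePoint.tendsto_coe_infty.comp htend)
        simp only [G, if_true]
        refine h1.congr' ?_
        filter_upwards [self_mem_nhdsWithin] with w hw
        exact (if_neg hw).symm
      have hd : ∀ᶠ w in 𝓝[≠] (0 : ℂ), DifferentiableAt ℂ G w := by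
        have hev : ∀ᶠ w : ℂ in 𝓝[≠] 0, w⁻¹ ∉ K := htend.eventually
          (by rw [coclosedCompact_eq_cocompact]; exact hK.compl_mem_cocompact)
        filter_upwards [hev, self_mem_nhdsWithin] with w hw hw0
        have h1 : DifferentiableAt ℂ (fun w : ℂ => F ((w⁻¹ : ℂ) : OnePoint ℂ)) w :=
          DifferentiableAt.comp (g := fun z : ℂ => F z) w (hdiff _ hw).self_of_nhds
            (differentiableAt_inv hw0)
        refine h1.congr_of_eventuallyEq ?_
        filter_upwards [isOpen_ne.mem_nhds hw0] with v hv
        exact if_neg hv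
      have han := Complex.analyticAt_of_differentiable_on_punctured_nhds_of_continuousAt hd hcont
      have hG0 : ‖G 0‖ = ‖F p₀‖ := by simpa [G] using (show ‖F OnePoint.infty‖ = _ from hp)
      have hGmax : ∀ w, ‖G w‖ ≤ ‖F p₀‖ := fun w => by
        simp only [G]; split_ifs <;> exact hmax _
      have hloc := Complex.norm_eventually_eq_of_isLocalMax (f := G) (c := 0)
        (han.eventually_analyticAt.mono fun _ h => h.differentiableAt)
        (Eventually.of_forall fun y => by simp only [Function.comp]; rw [hG0]; exact hGmax _)
      rw [OnePoint.nhds_infty_eq, mem_sup]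
      refine ⟨?_, hp⟩
      rw [coclosedCompact_eq_cocompact, ← Metric.cobounded_eq_cocompact, mem_map]
      have htend' : Tendsto (fun z : ℂ => z⁻¹) (Bornology.cobounded ℂ) (𝓝 0) :=
        Filter.tendsto_inv₀_cobounded
      filter_upwards [htend'.eventually hloc, Bornology.eventually_ne_cobounded 0] with z hz hz0
      have : G z⁻¹ = F z := by simp [G, hz0]
      rw [this, hG0] at hz
      exact hz
  have hclosed : IsClosed Z := isClosed_eq (by fun_prop) continuous_const
  have huniv : Z = univ := IsClopen.eq_univ ⟨hclosed, hopen⟩ ⟨p₀, rfl⟩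
  obtain ⟨w, hw⟩ := hne
  exact hZK w hw (huniv ▸ mem_univ _)

/-- If some functions that are holomorphic off a compact plane set separate its points, then their
restrictions to a homeomorphic copy generate a closed algebra without non-trivial idempotents. -/
theorem not_hasNTIP_of_sphereAlgebra {S : Type*} [TopologicalSpace S] [CompactSpace S] [Nonempty S]
    {e : S → ℂ} (he : Continuous e)
    (hsep : ∀ s t, s ≠ t → ∃ F ∈ sphereAlgebra (range e)ᶜ, F (e s) ≠ F (e t)) :
    ¬ HasNTIP S := by
  intro hS
  let ι : C(S, OnePoint ℂ) := ⟨fun s => (e s : OnePoint ℂ), OnePoint.continuous_coe.comp he⟩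
  let B := (sphereAlgebra (range e)ᶜ).topologicalClosure
  let R : C(OnePoint ℂ, ℂ) →ₐ[ℂ] C(S, ℂ) := ContinuousMap.compRightAlgHom ℂ ℂ ι
  have hRc : Continuous R := ContinuousMap.continuous_precomp ι
  -- The maximum principle passes to the closure, so restriction is isometric on `B` and its image
  -- is complete, hence closed.
  have hBnorm : ∀ F ∈ B, ‖F‖ ≤ ‖R F‖ := by
    have hcl : IsClosed {F : C(OnePoint ℂ, ℂ) | ‖F‖ ≤ ‖R F‖} :=
      isClosed_le continuous_norm hRc.norm
    refine fun F hF => closure_minimal ?_ hcl hF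
    intro F hF
    obtain ⟨w, ⟨s, rfl⟩, hw⟩ := exists_norm_le_of_mem_sphereAlgebra (isCompact_range he)
      (range_nonempty e) hF
    exact (ContinuousMap.norm_le _ (norm_nonneg _)).2 fun p => (hw p).trans
      ((R F).norm_coe_le_norm s)
  have hBc : IsClosed (B : Set C(OnePoint ℂ, ℂ)) := Subalgebra.isClosed_topologicalClosure _
  have hclosed : IsClosed ((B.map R : Subalgebra ℂ C(S, ℂ)) : Set C(S, ℂ)) := by
    rw [Subalgebra.coe_map]
    have hanti : AntilipschitzWith 1 (fun F : B => R F) :=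
      AntilipschitzWith.of_le_mul_dist fun F G => by
        rw [NNReal.coe_one, one_mul, dist_eq_norm, dist_eq_norm, ← map_sub]
        exact hBnorm _ (F - G).2
    have hcomp : CompleteSpace B := hBc.completeSpace_coe
    have huc : UniformContinuous (fun F : B => R F) := by
      refine (LipschitzWith.of_dist_le_mul (K := 1) fun F G => ?_).uniformContinuous
      rw [NNReal.coe_one, one_mul, ContinuousMap.dist_le dist_nonneg]
      exact fun s => ContinuousMap.dist_apply_le_dist (f := F.1) (g := G.1) (ι s)
    have := hanti.isClosed_range huc
    rwa [image_eq_range]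
  obtain ⟨f, hf, H, ⟨a, ha⟩, hne, hfH⟩ := hS (B.map R) (fun s t hst => by
    obtain ⟨F, hF, hFst⟩ := hsep s t hst
    exact ⟨_, ⟨R F, ⟨F, Subalgebra.le_topologicalClosure _ hF, rfl⟩, rfl⟩, hFst⟩) hclosed
  obtain ⟨F, hF, rfl⟩ := hf
  -- The identity holds on `S`, hence on the whole sphere by the norm bound.
  have hidem : F * F - F = 0 := by
    have h1 : R (F * F - F) = 0 := by
      ext s
      have := hfH s
      rw [map_sub, map_mul, ContinuousMap.sub_apply, ContinuousMap.mul_apply]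
      erw [this]
      by_cases hs : s ∈ H <;> simp [hs]
    have h2 := hBnorm _ (B.sub_mem (B.mul_mem hF hF) hF)
    rw [h1, norm_zero] at h2
    exact norm_le_zero_iff.1 h2
  have h01 : ∀ p, F p = 0 ∨ F p = 1 := fun p => by
    have := DFunLike.congr_fun hidem p
    simp only [ContinuousMap.sub_apply, ContinuousMap.mul_apply, ContinuousMap.zero_apply] at this
    rcases mul_eq_zero.1 (show F p * (F p - 1) = 0 by linear_combination this) with h | h
    · exact Or.inl h
    · exact Or.inr (sub_eq_zero.1 h)
  have hclopen : IsClopen (F ⁻¹' {1}) := by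
    refine ⟨isClosed_singleton.preimage F.continuous, ?_⟩
    have : F ⁻¹' {1} = (F ⁻¹' {0})ᶜ := by
      ext p
      rcases h01 p with h | h <;> simp [h]
    rw [this]
    exact (isClosed_singleton.preimage F.continuous).isOpen_compl
  have hall := hclopen.eq_univ ⟨ι a, by
    have := hfH a
    rw [indicator_of_mem ha] at this
    exact this⟩
  apply hne
  rw [eq_univ_iff_forall]
  intro s
  by_contra hs
  have h1 := hfH s
  rw [indicator_of_notMem hs] at h1
  have h2 : ι s ∈ F ⁻¹' {1} := hall ▸ mem_univ _
  have h3 : F (ι s) = 1 := h2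
  have h4 : F (ι s) = 0 := h1
  exact one_ne_zero (h3.symm.trans h4)

/-! ### Continuous Cauchy transforms -/

/-- The kernel `1 / u`, truncated at distance `ρ` from the origin so as to be continuous. -/
noncomputable def truncatedInv (ρ : ℝ) (u : ℂ) : ℂ :=
  (starRingEnd ℂ) u / ((max ‖u‖ ρ : ℝ) : ℂ) ^ 2

theorem continuous_truncatedInv {ρ : ℝ} (hρ : 0 < ρ) : Continuous (truncatedInv ρ) := by
  refine Continuous.div (by fun_prop) (by fun_prop) fun u => ?_
  have : 0 < max ‖u‖ ρ := lt_max_of_lt_right hρ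
  exact pow_ne_zero _ (Complex.ofReal_ne_zero.2 this.ne')

theorem norm_truncatedInv_le {ρ : ℝ} (hρ : 0 < ρ) (u : ℂ) : ‖truncatedInv ρ u‖ ≤ ρ⁻¹ := by
  have h : 0 < max ‖u‖ ρ := lt_max_of_lt_right hρ
  rw [truncatedInv, norm_div, RCLike.norm_conj, norm_pow, Complex.norm_real, Real.norm_eq_abs,
    abs_of_pos h, div_le_iff₀ (by positivity)]
  have h1 := le_max_left ‖u‖ ρ
  have h2 := le_max_right ‖u‖ ρ
  rw [← div_eq_inv_mul, le_div_iff₀ hρ]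
  nlinarith [norm_nonneg u]

theorem truncatedInv_eq_inv {ρ : ℝ} {u : ℂ} (h : ρ ≤ ‖u‖) : truncatedInv ρ u = u⁻¹ := by
  rw [truncatedInv, max_eq_left h, Complex.inv_def, Complex.normSq_eq_norm_sq]
  push_cast
  rfl

section CauchyTransform

variable {S : Type*} [TopologicalSpace S] [CompactSpace S]
  [MeasurableSpace S] [OpensMeasurableSpace S]

/-- The Cauchy transform of a measure that gives little mass to small discs extends continuously
to the whole plane. -/
theorem exists_continuous_eq_integral_inv {μ : Measure S} [IsProbabilityMeasure μ] {e : S → ℂ}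
    (he : Continuous e) {ρ C : ℕ → ℝ} (hρ : ∀ n, 0 < ρ n) (hanti : Antitone ρ)
    (hρ0 : Tendsto ρ atTop (𝓝 0)) (hC : Summable C)
    (hμ : ∀ n z, 2 * (ρ (n + 1))⁻¹ * μ.real {s | ‖e s - z‖ < ρ n} ≤ C n) :
    ∃ f : ℂ → ℂ, Continuous f ∧ ∀ z ∉ range e, f z = ∫ s, (e s - z)⁻¹ ∂μ := by
  let F : ℕ → ℂ → ℂ := fun n z => ∫ s, truncatedInv (ρ n) (e s - z) ∂μ
  have hmeas : ∀ n z, AEStronglyMeasurable (fun s => truncatedInv (ρ n) (e s - z)) μ := fun n z =>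
    ((continuous_truncatedInv (hρ n)).comp (he.sub continuous_const)).aestronglyMeasurable
  have hint : ∀ n z, Integrable (fun s => truncatedInv (ρ n) (e s - z)) μ := fun n z =>
    Integrable.of_bound (hmeas n z) (ρ n)⁻¹
      (Eventually.of_forall fun s => norm_truncatedInv_le (hρ n) _)
  have hFc : ∀ n, Continuous (F n) := fun n =>
    continuous_of_dominated (bound := fun _ => (ρ n)⁻¹) (hmeas n)
      (fun z => Eventually.of_forall fun s => norm_truncatedInv_le (hρ n) _)
      (integrable_const _)
      (Eventually.of_forall fun s =>
        (continuous_truncatedInv (hρ n)).comp (continuous_const.sub continuous_id))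
  have hFd : ∀ n z, ‖F (n + 1) z - F n z‖ ≤ C n := fun n z => by
    refine le_trans ?_ (hμ n z)
    simp only [F]
    -- Consecutive truncated kernels agree outside the disc of radius `ρ n`, so only its mass enters
    -- the estimate.
    rw [← integral_sub (hint _ _) (hint _ _),
      ← setIntegral_eq_integral_of_forall_compl_eq_zero (s := {s | ‖e s - z‖ < ρ n})]
    · refine norm_setIntegral_le_of_norm_le_const (measure_lt_top _ _) fun s _ => ?_
      refine (norm_sub_le _ _).trans ?_
      have h1 := norm_truncatedInv_le (hρ (n + 1)) (e s - z)
      have h2 := norm_truncatedInv_le (hρ n) (e s - z)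
      have h3 : (ρ n)⁻¹ ≤ (ρ (n + 1))⁻¹ := inv_anti₀ (hρ _) (hanti n.le_succ)
      linarith
    · intro s hs
      have hs' : ρ n ≤ ‖e s - z‖ := not_lt.1 hs
      rw [truncatedInv_eq_inv hs', truncatedInv_eq_inv ((hanti n.le_succ).trans hs'), sub_self]
  -- The telescoping series is the uniform limit of the truncated transforms. Off the range, the
  -- truncation has no effect for large `n`.
  refine ⟨fun z => F 0 z + ∑' n, (F (n + 1) z - F n z),
    (hFc 0).add (continuous_tsum (fun n => (hFc (n + 1)).sub (hFc n)) hC hFd), fun z hz => ?_⟩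
  have hsum : Summable fun n => F (n + 1) z - F n z := Summable.of_norm_bounded hC (hFd · z)
  have h1 := hsum.hasSum.tendsto_sum_nat
  simp only [Finset.sum_range_sub (fun n => F n z)] at h1
  have h2 : Tendsto (fun n => F n z - F 0 z) atTop (𝓝 (∫ s, (e s - z)⁻¹ ∂μ - F 0 z)) := by
    refine tendsto_const_nhds.congr' ?_
    have hcl : IsClosed (range e) := (isCompact_range he).isClosed
    obtain ⟨δ, hδ, hball⟩ := Metric.isOpen_iff.1 hcl.isOpen_compl z hz
    filter_upwards [hρ0.eventually_lt_const hδ] with n hn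
    congr 1
    refine integral_congr_ae (Eventually.of_forall fun s => ?_)
    refine (truncatedInv_eq_inv ?_).symm
    by_contra! hlt
    exact hball (by rw [Metric.mem_ball, dist_eq_norm]; exact hlt.trans hn) ⟨s, rfl⟩
  linear_combination tendsto_nhds_unique h1 h2

theorem differentiableOn_integral_inv {μ : Measure S} [IsProbabilityMeasure μ] {e : S → ℂ}
    (he : Continuous e) :
    DifferentiableOn ℂ (fun z => ∫ s, (e s - z)⁻¹ ∂μ) (range e)ᶜ := by
  intro z₀ hz₀
  obtain ⟨δ, hδ, hball⟩ := Metric.isOpen_iff.1 (isCompact_range he).isClosed.isOpen_compl z₀ hz₀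
  have hdist : ∀ z ∈ Metric.ball z₀ (δ / 2), ∀ s, δ / 2 ≤ ‖e s - z‖ := fun z hz s => by
    have h1 : ¬ dist (e s) z₀ < δ := fun h => hball h ⟨s, rfl⟩
    have h2 := dist_triangle (e s) z z₀
    rw [← dist_eq_norm]
    rw [Metric.mem_ball] at hz
    linarith
  have hne : ∀ z ∈ Metric.ball z₀ (δ / 2), ∀ s, e s - z ≠ 0 := fun z hz s =>
    norm_pos_iff.1 ((half_pos hδ).trans_le (hdist z hz s))
  have hc : ∀ z ∈ Metric.ball z₀ (δ / 2), Continuous fun s => (e s - z)⁻¹ := fun z hz =>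
    (he.sub continuous_const).inv₀ (hne z hz)
  have hz₀m := Metric.mem_ball_self (x := z₀) (half_pos hδ)
  refine (hasDerivAt_integral_of_dominated_loc_of_deriv_le (μ := μ)
    (F := fun z s => (e s - z)⁻¹) (F' := fun z s => ((e s - z) ^ 2)⁻¹)
    (bound := fun _ => ((δ / 2) ^ 2)⁻¹) (Metric.ball_mem_nhds z₀ (half_pos hδ))
    ?_ ?_ ?_ ?_ (integrable_const _) ?_).2.differentiableAt.differentiableWithinAt
  · filter_upwards [Metric.ball_mem_nhds z₀ (half_pos hδ)] with z hz
    exact (hc z hz).aestronglyMeasurable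
  · exact Integrable.of_bound (hc z₀ hz₀m).aestronglyMeasurable (δ / 2)⁻¹
      (Eventually.of_forall fun s => by
        rw [norm_inv]; exact inv_anti₀ (half_pos hδ) (hdist z₀ hz₀m s))
  · exact (((he.sub continuous_const).pow 2).inv₀
      fun s => pow_ne_zero 2 (hne z₀ hz₀m s)).aestronglyMeasurable
  · refine Eventually.of_forall fun s z hz => ?_
    rw [norm_inv, norm_pow]
    exact inv_anti₀ (by positivity) (pow_le_pow_left₀ (half_pos hδ).le (hdist z hz s) 2)
  · refine Eventually.of_forall fun s z hz => ?_
    have := ((hasDerivAt_id z).const_sub (e s)).inv (hne z hz s)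
    convert! this using 1
    simp

/-- A compact plane set that carries a measure with continuous Cauchy transform fails the NTIP. -/
theorem not_hasNTIP_of_continuous_cauchyTransform [Nonempty S] {μ : Measure S}
    [IsProbabilityMeasure μ] {e : S → ℂ}
    (he : Continuous e) (hinj : Function.Injective e) {f : ℂ → ℂ} (hf : Continuous f)
    (hfe : ∀ z ∉ range e, f z = ∫ s, (e s - z)⁻¹ ∂μ) : ¬ HasNTIP S := by
  have hcl : IsClosed (range e) := (isCompact_range he).isClosed
  have hfd : DifferentiableOn ℂ f (range e)ᶜ := (differentiableOn_integral_inv he).congr hfe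
  obtain ⟨R, hR0, hR⟩ : ∃ R, 0 < R ∧ ∀ s, ‖e s‖ ≤ R := by
    obtain ⟨R, hR⟩ := (isCompact_range he).isBounded.exists_norm_le
    exact ⟨max R 1, by positivity, fun s => (hR _ ⟨s, rfl⟩).trans (le_max_left _ _)⟩
  have hout : ∀ z, R < ‖z‖ → z ∉ range e := by
    rintro _ h ⟨s, rfl⟩
    exact absurd (hR s) (not_le.2 h)
  have hbd : ∀ z, R < ‖z‖ → ‖f z‖ ≤ (‖z‖ - R)⁻¹ := fun z hz => by
    rw [hfe z (hout z hz)]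
    have := norm_integral_le_of_norm_le_const (μ := μ) (f := fun s => (e s - z)⁻¹)
      (C := (‖z‖ - R)⁻¹) (Eventually.of_forall fun s => by
        rw [norm_inv]
        refine inv_anti₀ (sub_pos.2 hz) ?_
        have h1 := norm_sub_norm_le z (e s)
        rw [norm_sub_rev] at h1
        linarith [hR s])
    simpa using this
  have hinf : Tendsto f (Bornology.cobounded ℂ) (𝓝 0) := by
    refine squeeze_zero_norm' (a := fun z => (‖z‖ - R)⁻¹) ?_ ?_
    · filter_upwards [tendsto_norm_cobounded_atTop.eventually_gt_atTop R] with z hz using hbd z hz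
    · exact (tendsto_atTop_add_const_right _ (-R) tendsto_norm_cobounded_atTop).inv_tendsto_atTop
  have hnz : ∃ z ∉ range e, f z ≠ 0 := by
    -- From a point this far to the left, all `e s - z` have real part at least `1`, so the integral
    -- has positive real part.
    refine ⟨((-(R + 1) : ℝ) : ℂ), hout _ ?_, ?_⟩
    · rw [Complex.norm_real, Real.norm_eq_abs, abs_neg, abs_of_pos (by positivity)]; linarith
    have hzo : ((-(R + 1) : ℝ) : ℂ) ∉ range e := hout _ (by
      rw [Complex.norm_real, Real.norm_eq_abs, abs_neg, abs_of_pos (by positivity)]; linarith)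
    set z : ℂ := ((-(R + 1) : ℝ) : ℂ)
    have hre : ∀ s, 1 ≤ (e s - z).re := fun s => by
      have h1 := (abs_le.1 ((Complex.abs_re_le_norm (e s)).trans (hR s))).1
      simp only [z, Complex.sub_re, Complex.ofReal_re]
      linarith
    have hne : ∀ s, e s - z ≠ 0 := fun s h => by
      have := hre s; rw [h] at this; norm_num at this
    have hci : Continuous fun s => (e s - z)⁻¹ := (he.sub continuous_const).inv₀ hne
    have hint : Integrable (fun s => (e s - z)⁻¹) μ := by
      refine Integrable.of_bound hci.aestronglyMeasurable 1 (Eventually.of_forall fun s => ?_)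
      rw [norm_inv]
      exact inv_le_one_of_one_le₀ ((hre s).trans (Complex.re_le_norm _))
    have hpos : 0 < ∫ s, ((e s - z)⁻¹).re ∂μ := by
      have hpt : ∀ s, 0 < ((e s - z)⁻¹).re := fun s => by
        rw [Complex.inv_re]
        exact div_pos (zero_lt_one.trans_le (hre s)) (Complex.normSq_pos.2 (hne s))
      rw [integral_pos_iff_support_of_nonneg (fun s => (hpt s).le) hint.re,
        Set.eq_univ_of_forall (s := Function.support _) fun s => (hpt s).ne', measure_univ]
      exact one_pos
    intro h
    rw [hfe _ hzo] at h
    have := congrArg Complex.re h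
    rw [show (∫ s, (e s - z)⁻¹ ∂μ).re = ∫ s, ((e s - z)⁻¹).re ∂μ from
      (integral_re hint).symm, Complex.zero_re] at this
    exact hpos.ne' this
  have hval : ∀ c, ∃ z ∉ range e, f z ≠ c := by
    intro c
    by_cases hc : c = 0
    · exact hc ▸ hnz
    obtain ⟨z, hz1, hz2⟩ := ((hinf.eventually_ne (Ne.symm hc)).and
      (tendsto_norm_cobounded_atTop.eventually_gt_atTop R)).exists
    exact ⟨z, hout z hz2, hz1⟩
  have hcc : coclosedCompact ℂ = Bornology.cobounded ℂ := by
    rw [coclosedCompact_eq_cocompact, Metric.cobounded_eq_cocompact]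
  refine not_hasNTIP_of_sphereAlgebra he fun s t hst => ?_
  by_cases hfst : f (e s) = f (e t)
  -- When `f` does not separate, the quotient `(f z - f z₀) / (z - z₀)` does: its numerators at `e
  -- s` and `e t` are equal and non-zero, its denominators differ.
  · obtain ⟨z₀, hz₀, hfz₀⟩ := hval (f (e s))
    have hd₀ : DifferentiableAt ℂ f z₀ := (hfd z₀ hz₀).differentiableAt (hcl.isOpen_compl.mem_nhds hz₀)
    have hgc : Continuous (dslope f z₀) := continuousOn_univ.1
      ((continuousOn_dslope univ_mem).2 ⟨hf.continuousOn, hd₀⟩)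
    have hgd : DifferentiableOn ℂ (dslope f z₀) (range e)ᶜ :=
      (Complex.differentiableOn_dslope (hcl.isOpen_compl.mem_nhds hz₀)).2 hfd
    have hginf : Tendsto (dslope f z₀) (coclosedCompact ℂ) (𝓝 0) := by
      rw [hcc]
      have h1 : Tendsto (fun z : ℂ => (z - z₀)⁻¹) (Bornology.cobounded ℂ) (𝓝 0) :=
        Filter.tendsto_inv₀_cobounded.comp (by
          exact tendsto_sub_const_cobounded z₀)
      have h2 := h1.mul (hinf.sub_const (f z₀))
      rw [zero_mul] at h2
      refine h2.congr' ?_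
      filter_upwards [Bornology.eventually_ne_cobounded z₀] with z hz
      rw [dslope_of_ne _ hz, slope_def_module, smul_eq_mul]
    refine ⟨OnePoint.continuousMapMk ⟨dslope f z₀, hgc⟩ 0 hginf, hgd, fun h => ?_⟩
    have h : dslope f z₀ (e s) = dslope f z₀ (e t) := h
    have hs : e s ≠ z₀ := fun h => hz₀ ⟨s, h⟩
    have ht : e t ≠ z₀ := fun h => hz₀ ⟨t, h⟩
    rw [dslope_of_ne _ hs, dslope_of_ne _ ht, slope_def_module, slope_def_module, ← hfst,
      smul_eq_mul, smul_eq_mul] at h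
    have h1 := mul_right_cancel₀ (sub_ne_zero.2 hfz₀.symm) h
    exact hst (hinj (sub_left_injective (inv_injective h1)))
  · exact ⟨OnePoint.continuousMapMk ⟨f, hf⟩ 0 (hcc ▸ hinf), hfd, hfst⟩

end CauchyTransform

/-! ### The Cantor square in the plane -/

/-- The self-similar embedding of `ℕ → Bool` into the line with ratio `1 / 3`. -/
noncomputable def ternaryReal (ω : ℕ → Bool) : ℝ := ∑' k, if ω k then (1 / 3 : ℝ) ^ k else 0

theorem summable_ternaryReal (ω : ℕ → Bool) :
    Summable fun k => if ω k then (1 / 3 : ℝ) ^ k else 0 :=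
  Summable.of_nonneg_of_le (fun k => by split_ifs <;> positivity)
    (fun k => by split_ifs <;> simp) (summable_geometric_of_lt_one (r := 1 / 3) (by norm_num) (by norm_num))

theorem continuous_ternaryReal : Continuous ternaryReal := by
  refine continuous_tsum (u := fun k => (1 / 3 : ℝ) ^ k) (fun k => ?_)
    (summable_geometric_of_lt_one (by norm_num) (by norm_num)) fun k ω => ?_
  · exact (continuous_of_discreteTopology (f := fun b : Bool => if b then (1 / 3 : ℝ) ^ k else 0)).comp
      (continuous_apply k)
  · split_ifs <;> simp

theorem ternaryReal_nonneg (ω : ℕ → Bool) : 0 ≤ ternaryReal ω :=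
  tsum_nonneg fun k => by split_ifs <;> positivity

theorem ternaryReal_le (ω : ℕ → Bool) : ternaryReal ω ≤ 3 / 2 := by
  have h := (summable_ternaryReal ω).tsum_le_tsum (g := fun k => (1 / 3 : ℝ) ^ k)
    (fun k => by split_ifs <;> simp) (summable_geometric_of_lt_one (by norm_num) (by norm_num))
  rw [tsum_geometric_of_lt_one (by norm_num) (by norm_num)] at h
  exact h.trans (by norm_num)

theorem ternaryReal_eq (ω : ℕ → Bool) :
    ternaryReal ω = (if ω 0 then 1 else 0) + ternaryReal (fun k => ω (k + 1)) / 3 := by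
  rw [ternaryReal, (summable_ternaryReal ω).tsum_eq_zero_add, ternaryReal, ← tsum_div_const,
    pow_zero]
  congr 1
  refine tsum_congr fun k => ?_
  split_ifs
  · rw [pow_succ]; ring
  · simp

/-- If the first differing digit has index `k`, it contributes `3⁻ᵏ` and the later digits cancel at
most half of that. -/
theorem eq_of_abs_ternaryReal_sub_lt {n : ℕ} {ω ω' : ℕ → Bool}
    (h : |ternaryReal ω - ternaryReal ω'| < (1 / 3 : ℝ) ^ n / 2) {k : ℕ} (hk : k ≤ n) :
    ω k = ω' k := by
  induction n generalizing ω ω' k with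
  | zero =>
    obtain rfl : k = 0 := by omega
    rw [ternaryReal_eq ω, ternaryReal_eq ω', abs_lt] at h
    have h1 := ternaryReal_nonneg fun k => ω (k + 1)
    have h2 := ternaryReal_nonneg fun k => ω' (k + 1)
    have h3 := ternaryReal_le fun k => ω (k + 1)
    have h4 := ternaryReal_le fun k => ω' (k + 1)
    cases hω : ω 0 <;> cases hω' : ω' 0 <;> simp_all <;> linarith
  | succ n ih =>
    have h0 : ω 0 = ω' 0 := by
      have hle : (1 / 3 : ℝ) ^ (n + 1) ≤ 1 := pow_le_one₀ (by norm_num) (by norm_num)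
      rw [ternaryReal_eq ω, ternaryReal_eq ω', abs_lt] at h
      have h1 := ternaryReal_nonneg fun k => ω (k + 1)
      have h2 := ternaryReal_nonneg fun k => ω' (k + 1)
      have h3 := ternaryReal_le fun k => ω (k + 1)
      have h4 := ternaryReal_le fun k => ω' (k + 1)
      cases hω : ω 0 <;> cases hω' : ω' 0 <;> simp_all <;> linarith
    cases k with
    | zero => exact h0
    | succ k =>
      refine ih (ω := fun k => ω (k + 1)) (ω' := fun k => ω' (k + 1)) ?_ (by omega)
      rw [ternaryReal_eq ω, ternaryReal_eq ω', h0, add_sub_add_left_eq_sub, ← sub_div, abs_div,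
        abs_of_pos (three_pos : (0 : ℝ) < 3), pow_succ] at h
      linarith

theorem injective_ternaryReal : Function.Injective ternaryReal := fun ω ω' h => by
  funext k
  exact eq_of_abs_ternaryReal_sub_lt (n := k) (by rw [h, sub_self, abs_zero]; positivity) le_rfl

/-- The fair coin tossing measure. -/
noncomputable def coinMeasure : Measure (ℕ → Bool) :=
  Measure.infinitePi fun _ => (PMF.uniformOfFintype Bool).toMeasure

instance : IsProbabilityMeasure coinMeasure := by
  unfold coinMeasure; infer_instance

/-- Two points of the interval are less than `3⁻ⁿ / 2` apart, so they share their first `n + 1`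
digits; the cylinder they determine has this mass. -/
theorem coinMeasure_real_le (n : ℕ) (x : ℝ) :
    coinMeasure.real {ω | |ternaryReal ω - x| < (1 / 3 : ℝ) ^ n / 4} ≤ (1 / 2) ^ (n + 1) := by
  rcases eq_empty_or_nonempty {ω | |ternaryReal ω - x| < (1 / 3 : ℝ) ^ n / 4} with h | ⟨ω₀, hω₀⟩
  · rw [h, measureReal_empty]; positivity
  have hsub : {ω | |ternaryReal ω - x| < (1 / 3 : ℝ) ^ n / 4} ⊆
      Set.pi (Finset.range (n + 1) : Set ℕ) fun k => {ω₀ k} := by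
    intro ω hω k hk
    refine eq_of_abs_ternaryReal_sub_lt (n := n) ?_ (by simpa [Nat.lt_succ_iff] using hk)
    have h1 : |ternaryReal ω - x| < (1 / 3 : ℝ) ^ n / 4 := hω
    have h2 : |ternaryReal ω₀ - x| < (1 / 3 : ℝ) ^ n / 4 := hω₀
    rw [abs_lt] at h1 h2 ⊢
    constructor <;> linarith
  refine (measureReal_mono hsub).trans_eq ?_
  rw [measureReal_def, coinMeasure, Measure.infinitePi_pi _ fun _ _ => measurableSet_singleton _]
  simp

/-- A disc of radius `3⁻ⁿ / 4` has mass at most `4⁻⁽ⁿ⁺¹⁾`, which beats the growth `8 * 3 ^ (n + 1)`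
of the kernel bound. The product is `6 * (3 / 4) ^ n`. On the linear set, the mass bound `2⁻⁽ⁿ⁺¹⁾`
would not suffice. -/
theorem not_hasNTIP_cantorSquare : ¬ HasNTIP ((ℕ → Bool) × (ℕ → Bool)) := by
  let e : (ℕ → Bool) × (ℕ → Bool) → ℂ := fun s => ⟨ternaryReal s.1, ternaryReal s.2⟩
  have he : Continuous e := by
    have : e = fun s => (ternaryReal s.1 : ℂ) + (ternaryReal s.2 : ℂ) * Complex.I := by
      funext s
      exact Complex.mk_eq_add_mul_I _ _
    rw [this]
    have := continuous_ternaryReal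
    fun_prop
  have hinj : Function.Injective e := fun s t h =>
    Prod.ext (injective_ternaryReal (congrArg Complex.re h))
      (injective_ternaryReal (congrArg Complex.im h))
  obtain ⟨f, hf, hfe⟩ := exists_continuous_eq_integral_inv (μ := coinMeasure.prod coinMeasure) he
    (ρ := fun n => (1 / 3 : ℝ) ^ n / 4) (C := fun n => 6 * (3 / 4 : ℝ) ^ n) (fun n => by positivity)
    (fun m n h => div_le_div_of_nonneg_right
      (pow_le_pow_of_le_one (by norm_num) (by norm_num) h) (by norm_num))
    (by simpa using (tendsto_pow_atTop_nhds_zero_of_lt_one (r := (1 / 3 : ℝ))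
      (by norm_num) (by norm_num)).div_const 4)
    ((summable_geometric_of_lt_one (by norm_num) (by norm_num)).mul_left 6) (fun n z => by
      have h1 : (coinMeasure.prod coinMeasure).real {s | ‖e s - z‖ < (1 / 3 : ℝ) ^ n / 4} ≤
          (1 / 2) ^ (n + 1) * (1 / 2) ^ (n + 1) := by
        have hsub : {s | ‖e s - z‖ < (1 / 3 : ℝ) ^ n / 4} ⊆
            {ω | |ternaryReal ω - z.re| < (1 / 3 : ℝ) ^ n / 4} ×ˢ
              {ω | |ternaryReal ω - z.im| < (1 / 3 : ℝ) ^ n / 4} := fun s hs =>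
          ⟨(Complex.abs_re_le_norm (e s - z)).trans_lt hs,
            (Complex.abs_im_le_norm (e s - z)).trans_lt hs⟩
        refine (measureReal_mono hsub).trans ?_
        rw [measureReal_prod_prod]
        exact mul_le_mul (coinMeasure_real_le n _) (coinMeasure_real_le n _) measureReal_nonneg
          (by positivity)
      calc _ ≤ 2 * ((1 / 3 : ℝ) ^ (n + 1) / 4)⁻¹ * ((1 / 2) ^ (n + 1) * (1 / 2) ^ (n + 1)) := by
            gcongr
        _ = 6 * (3 / 4 : ℝ) ^ n := by
            rw [← mul_pow, inv_div, div_eq_mul_inv, ← inv_pow, mul_assoc, mul_assoc, ← mul_pow,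
              pow_succ]
            norm_num
            ring)
  exact not_hasNTIP_of_continuous_cauchyTransform he hinj hf hfe

/-! ### Transfer to the Cantor set and failure of the CSWP -/

/-- The NTIP is a topological invariant. -/
theorem HasNTIP.of_homeomorph {X Y : Type*} [TopologicalSpace X] [TopologicalSpace Y] (φ : X ≃ₜ Y)
    (hX : HasNTIP X) : HasNTIP Y := by
  intro A hsep hA
  let R : C(Y, ℂ) →ₐ[ℂ] C(X, ℂ) := ContinuousMap.compRightAlgHom ℂ ℂ ⟨φ, φ.continuous⟩
  let R' : C(X, ℂ) →ₐ[ℂ] C(Y, ℂ) := ContinuousMap.compRightAlgHom ℂ ℂ ⟨φ.symm, φ.symm.continuous⟩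
  have hRR : ∀ f, R (R' f) = f := fun f => by ext x; simp [R, R']
  obtain ⟨f, hf, H, ⟨a, ha⟩, hne, hfH⟩ := hX (A.comap R') (fun s t hst => by
    obtain ⟨_, ⟨f, hf, rfl⟩, hfst⟩ := hsep (φ.injective.ne hst)
    refine ⟨_, ⟨R f, ?_, rfl⟩, hfst⟩
    change R' (R f) ∈ A
    have : R' (R f) = f := by ext y; simp [R, R']
    rwa [this]) (hA.preimage (ContinuousMap.continuous_precomp _))
  refine ⟨R' f, hf, φ '' H, ⟨φ a, a, ha, rfl⟩, fun h => hne ?_, fun y => ?_⟩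
  · rw [← preimage_image_eq H φ.injective, h, preimage_univ]
  · obtain ⟨x, rfl⟩ := φ.surjective y
    simp only [R', ContinuousMap.compRightAlgHom_apply, ContinuousMap.comp_apply,
      ContinuousMap.coe_mk, Homeomorph.symm_apply_apply, hfH]
    by_cases hx : x ∈ H
    · rw [indicator_of_mem hx, indicator_of_mem (mem_image_of_mem φ hx)]
    · rw [indicator_of_notMem hx, indicator_of_notMem]
      rwa [φ.injective.mem_set_image]

theorem not_hasNTIP_cantorSet : ¬ HasNTIP cantorSet := fun h =>
  not_hasNTIP_cantorSquare <| h.of_homeomorph <| cantorSetHomeomorphNatToBool.trans <|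
    (Homeomorph.piCongrLeft (Y := fun _ => Bool) Equiv.natSumNatEquivNat.symm).trans
      Homeomorph.sumArrowHomeomorphProdArrow

/-- A compact space containing a closed disconnected subspace without the NTIP fails the CSWP. -/
theorem not_hasCSWP_of_isClosedEmbedding {K X : Type*} [TopologicalSpace K] [TopologicalSpace X]
    [CompactSpace X] [T2Space X] {i : K → X} (hi : IsClosedEmbedding i) (hK : ¬ HasNTIP K)
    (hH : ∃ H : Set K, IsClopen H ∧ H.Nonempty ∧ H ≠ univ) : ¬ HasCSWP X := by
  intro hX
  unfold HasNTIP at hK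
  push Not at hK
  obtain ⟨A, hsep, hA, hno⟩ := hK
  let R : C(X, ℂ) →ₐ[ℂ] C(K, ℂ) := ContinuousMap.compRightAlgHom ℂ ℂ ⟨i, hi.continuous⟩
  have hRc : Continuous R := ContinuousMap.continuous_precomp _
  have hsurj : Function.Surjective R := fun f => by
    obtain ⟨F, hF⟩ := f.exists_extension hi
    exact ⟨F, hF⟩
  -- Functions vanishing on the copy of `K` lie in the pulled-back algebra, so Urysohn functions
  -- separate points off the copy.
  have hsepX : ∀ x y, x ∉ range i → x ≠ y → ∃ F ∈ A.comap R, F x ≠ F y := by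
    intro x y hx hxy
    obtain ⟨u, hu0, hu1, -⟩ := exists_continuous_zero_one_of_isClosed
      (hi.isClosed_range.union (isClosed_singleton (x := y))) (isClosed_singleton (x := x))
      (disjoint_singleton_right.2 (by rintro (h | h); exacts [hx h, hxy h]))
    let F : C(X, ℂ) := ⟨fun x => (u x : ℂ), Complex.continuous_ofReal.comp u.continuous⟩
    refine ⟨F, ?_, ?_⟩
    · have : R F = 0 := by
        ext k
        change ((u (i k) : ℝ) : ℂ) = 0
        rw [hu0 (Or.inl ⟨k, rfl⟩)]
        simp
      change R F ∈ A
      rw [this]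
      exact A.zero_mem
    · change ((u x : ℝ) : ℂ) ≠ ((u y : ℝ) : ℂ)
      rw [hu1 rfl, hu0 (Or.inr rfl)]
      simp
  have hdense := hX (A.comap R) (fun x y hxy => by
    suffices h : ∃ F ∈ A.comap R, F x ≠ F y by
      obtain ⟨F, hF, h⟩ := h
      exact ⟨F, ⟨F, hF, rfl⟩, h⟩
    by_cases hx : x ∈ range i
    · by_cases hy : y ∈ range i
      · obtain ⟨a, rfl⟩ := hx
        obtain ⟨b, rfl⟩ := hy
        obtain ⟨_, ⟨f, hf, rfl⟩, hab⟩ := hsep (show a ≠ b from fun h => hxy (h ▸ rfl))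
        obtain ⟨F, rfl⟩ := hsurj f
        exact ⟨F, hf, hab⟩
      · obtain ⟨F, hF, h⟩ := hsepX y x hy hxy.symm
        exact ⟨F, hF, h.symm⟩
    · exact hsepX x y hx hxy)
  -- Density passes to `A` through the surjective restriction map; being closed, `A` would be
  -- everything and contain the indicator of a clopen set.
  have huniv : (A : Set C(K, ℂ)) = univ := by
    have h1 : Dense (A : Set C(K, ℂ)) := (hsurj.denseRange.dense_image hRc hdense).mono (by
      rintro _ ⟨F, hF, rfl⟩
      exact hF)
    rw [← hA.closure_eq, h1.closure_eq]
  obtain ⟨H, hHc, hHne, hHu⟩ := hH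
  let χ : C(K, ℂ) := ⟨H.indicator fun _ => 1, hHc.continuous_indicator continuous_const⟩
  obtain ⟨x, hx⟩ := hno χ (show χ ∈ (A : Set C(K, ℂ)) from huniv ▸ mem_univ _) H hHne hHu
  exact hx rfl

instance : PerfectSpace (ℕ → Bool) := by
  refine ⟨preperfect_iff_nhds.2 fun x _ U hU => ?_⟩
  have h : Tendsto (fun n => Function.update x n (!x n)) atTop (𝓝 x) := by
    rw [tendsto_pi_nhds]
    intro k
    refine tendsto_const_nhds.congr' ?_
    filter_upwards [eventually_gt_atTop k] with n hn
    rw [Function.update_of_ne hn.ne]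
  obtain ⟨n, hn⟩ := (h.eventually hU).exists
  refine ⟨_, ⟨hn, mem_univ _⟩, fun he => ?_⟩
  have := congrFun he n
  simp at this

instance : PerfectSpace cantorSet := by
  refine ⟨preperfect_iff_nhds.2 fun x _ U hU => ?_⟩
  let φ := cantorSetHomeomorphNatToBool
  obtain ⟨y, ⟨hy, -⟩, hne⟩ := preperfect_iff_nhds.1 PerfectSpace.univ_preperfect (φ x) (mem_univ _)
    (φ.symm ⁻¹' U) (φ.symm.continuous.continuousAt.preimage_mem_nhds (by simpa using hU))
  exact ⟨φ.symm y, ⟨hy, mem_univ _⟩, fun h => hne (by rw [← h, φ.apply_symm_apply])⟩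

instance : Uncountable cantorSet := by
  have : Uncountable (ℕ → Bool) := by
    rw [← Cardinal.aleph0_lt_mk_iff]
    simpa using Cardinal.aleph0_lt_continuum
  exact cantorSetHomeomorphNatToBool.symm.injective.uncountable

instance : CompactSpace cantorSet := isCompact_iff_compactSpace.1 isCompact_cantorSet

instance : Nonempty cantorSet := ⟨⟨0, zero_mem_cantorSet⟩⟩

instance : TotallySeparatedSpace cantorSet := by
  have : TotallyDisconnectedSpace cantorSet := by
    refine ⟨fun t _ ht => ?_⟩
    have h := (ht.image _ cantorSetHomeomorphNatToBool.continuous.continuousOn).subsingleton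
    exact fun x hx y hy => cantorSetHomeomorphNatToBool.injective
      (h (mem_image_of_mem _ hx) (mem_image_of_mem _ hy))
  infer_instance

theorem exists_isClopen_nontrivial_cantorSet :
    ∃ H : Set cantorSet, IsClopen H ∧ H.Nonempty ∧ H ≠ univ := by
  have : Nontrivial cantorSet := inferInstance
  obtain ⟨x, y, hxy⟩ := exists_pair_ne cantorSet
  obtain ⟨U, hU, hx, hy⟩ := exists_isClopen_of_totally_separated hxy
  exact ⟨U, hU, ⟨x, hx⟩, fun h => hy (h ▸ mem_univ y)⟩

/-! ### The Aleksandrov duplicate -/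

namespace AleksandrovDuplicate

variable {K : Type*}

/-- The inclusion of the original copy. -/
def base (x : K) : AleksandrovDuplicate K := ((x, false) : K × Bool)

/-- The isolated twin of a point. -/
def twin (x : K) : AleksandrovDuplicate K := ((x, true) : K × Bool)

/-- The projection onto the original space. -/
def proj (p : AleksandrovDuplicate K) : K := Prod.fst p

theorem base_injective : Function.Injective (base (K := K)) := fun _ _ h => congrArg proj h

theorem eq_base_or_twin (p : AleksandrovDuplicate K) : p = base (proj p) ∨ p = twin (proj p) := by
  obtain ⟨x, b⟩ := p
  cases b
  · exact Or.inl rfl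
  · exact Or.inr rfl

theorem base_ne_twin (x y : K) : base x ≠ twin y := fun h =>
  Bool.false_ne_true (congrArg (fun p : AleksandrovDuplicate K => Prod.snd p) h)

theorem twin_ne_base (x y : K) : twin x ≠ base y := (base_ne_twin y x).symm

variable [TopologicalSpace K]

theorem isOpen_iff {s : Set (AleksandrovDuplicate K)} : IsOpen s ↔ ∀ x, base x ∈ s →
    ∃ U : Set K, IsOpen U ∧ x ∈ U ∧ (∀ y ∈ U, base y ∈ s) ∧ ∀ y ∈ U, y ≠ x → twin y ∈ s := by
  refine forall₂_congr fun x _ => exists_congr fun U => and_congr_right fun _ =>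
    and_congr_right fun _ => ⟨fun h => ⟨fun y hy => ?_, fun y hy hne => ?_⟩, fun h => ?_⟩
  · exact h ⟨⟨hy, mem_univ _⟩, base_ne_twin y x⟩
  · exact h ⟨⟨hy, mem_univ _⟩, fun he => hne (congrArg proj he)⟩
  · rintro ⟨y, b⟩ ⟨⟨hy, -⟩, hne⟩
    cases b
    · exact h.1 y hy
    · exact h.2 y hy fun he => hne (congrArg twin he)

theorem continuous_base : Continuous (base (K := K)) := by
  refine continuous_def.2 fun s hs => isOpen_iff_mem_nhds.2 fun x hx => ?_
  obtain ⟨U, hU, hxU, h, -⟩ := isOpen_iff.1 hs x hx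
  exact mem_of_superset (hU.mem_nhds hxU) h

theorem continuous_proj : Continuous (proj (K := K)) :=
  continuous_def.2 fun U hU => isOpen_iff.2 fun _ hx =>
    ⟨U, hU, hx, fun _ hy => hy, fun _ hy _ => hy⟩

theorem isOpen_of_disjoint_range_base {s : Set (AleksandrovDuplicate K)}
    (h : ∀ x, base x ∉ s) : IsOpen s := isOpen_iff.2 fun x hx => absurd hx (h x)

theorem isClopen_singleton_twin [T1Space K] (x : K) : IsClopen {twin x} := by
  refine ⟨⟨isOpen_iff.2 fun y _ => ?_⟩, isOpen_of_disjoint_range_base fun y => base_ne_twin y x⟩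
  by_cases hxy : y = x
  · subst hxy
    exact ⟨univ, isOpen_univ, mem_univ _, fun z _ => base_ne_twin z y,
      fun z _ hne he => hne (congrArg proj he)⟩
  · exact ⟨{x}ᶜ, isOpen_compl_singleton, hxy, fun z _ => base_ne_twin z x,
      fun z hz _ he => hz (congrArg proj he)⟩

instance [TotallySeparatedSpace K] : TotallySeparatedSpace (AleksandrovDuplicate K) := by
  rw [totallySeparatedSpace_iff_exists_isClopen]
  intro p q hpq
  by_cases h : proj p = proj q
  · rcases eq_base_or_twin p with hp | hp <;> rcases eq_base_or_twin q with hq | hq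
    · exact absurd (hp.trans (h ▸ hq.symm)) hpq
    · refine ⟨{twin (proj q)}ᶜ, (isClopen_singleton_twin _).compl, ?_, ?_⟩
      · rw [hp]; exact base_ne_twin _ _
      · rw [compl_compl, hq]; rfl
    · refine ⟨{twin (proj p)}, isClopen_singleton_twin _, ?_, ?_⟩
      · rw [hp]; rfl
      · rw [hq]; exact base_ne_twin _ _
    · exact absurd (hp.trans (h ▸ hq.symm)) hpq
  · obtain ⟨U, hU, hp, hq⟩ := exists_isClopen_of_totally_separated h
    exact ⟨proj ⁻¹' U, hU.preimage continuous_proj, hp, hq⟩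

/-- In the duplicate of a compact space, a neighbourhood of the original copy is cofinite. -/
theorem finite_compl_of_isOpen [CompactSpace K] {W : Set (AleksandrovDuplicate K)} (hW : IsOpen W)
    (h : ∀ x, base x ∈ W) : Wᶜ.Finite := by
  choose U hU hxU _ hUW using fun x => isOpen_iff.1 hW x (h x)
  obtain ⟨t, ht⟩ := isCompact_univ.elim_finite_subcover U hU
    fun x _ => mem_iUnion.2 ⟨x, hxU x⟩
  refine (t.finite_toSet.image twin).subset fun p hp => ?_
  rcases eq_base_or_twin p with hp' | hp'
  · exact absurd (hp' ▸ h _) hp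
  · obtain ⟨x, hx, hpx⟩ := mem_iUnion₂.1 (ht (mem_univ (proj p)))
    by_cases hne : proj p = x
    · exact ⟨x, hx, hne ▸ hp'.symm⟩
    · exact absurd (hp' ▸ hUW x _ hpx hne) hp

instance [CompactSpace K] : CompactSpace (AleksandrovDuplicate K) := by
  refine ⟨isCompact_of_finite_subcover fun {ι} U hU hcov => ?_⟩
  obtain ⟨t, ht⟩ := (isCompact_range (continuous_base (K := K))).elim_finite_subcover U hU
    fun p _ => hcov (mem_univ p)
  have hfin : (⋃ i ∈ t, U i)ᶜ.Finite :=
    finite_compl_of_isOpen (isOpen_biUnion fun i _ => hU i) fun x => ht ⟨x, rfl⟩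
  obtain ⟨t', ht'⟩ := hfin.isCompact.elim_finite_subcover U hU fun p _ => hcov (mem_univ p)
  classical
  refine ⟨t ∪ t', fun p _ => ?_⟩
  rw [Finset.set_biUnion_union]
  by_cases hp : p ∈ ⋃ i ∈ t, U i
  · exact Or.inl hp
  · exact Or.inr (ht' hp)

theorem isClosed_range_base : IsClosed (range (base (K := K))) :=
  ⟨isOpen_of_disjoint_range_base fun x hx => hx ⟨x, rfl⟩⟩

theorem isClosedEmbedding_base [CompactSpace K] [TotallySeparatedSpace K] :
    IsClosedEmbedding (base (K := K)) :=
  continuous_base.isClosedEmbedding base_injective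

/-- The base copy inherits perfectness from `K`, while a twin is isolated in any set containing it.
-/
theorem spaceKernel_eq_range_base [PerfectSpace K] :
    spaceKernel (AleksandrovDuplicate K) = range base := by
  refine (isGreatest_spaceKernel _).unique ⟨⟨isClosed_range_base, ?_⟩, fun P hP p hp => ?_⟩
  · rw [preperfect_iff_nhds]
    rintro _ ⟨x, rfl⟩ U hU
    obtain ⟨y, ⟨hy, -⟩, hne⟩ := preperfect_iff_nhds.1 PerfectSpace.univ_preperfect x (mem_univ x)
      (base ⁻¹' U) (continuous_base.continuousAt.preimage_mem_nhds hU)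
    exact ⟨base y, ⟨hy, y, rfl⟩, base_injective.ne hne⟩
  · rcases eq_base_or_twin p with hp' | hp'
    · exact ⟨_, hp'.symm⟩
    · obtain ⟨y, ⟨hy, -⟩, hne⟩ := preperfect_iff_nhds.1 hP.acc p hp {p} (by
        rw [hp']
        exact (isOpen_of_disjoint_range_base fun y => base_ne_twin y _).mem_nhds rfl)
      exact absurd hy hne

theorem not_hasNTIP_spaceKernel [CompactSpace K] [TotallySeparatedSpace K] [PerfectSpace K]
    (h : ¬ HasNTIP K) : ¬ HasNTIP (spaceKernel (AleksandrovDuplicate K)) := fun hX =>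
  h <| hX.of_homeomorph <| (Homeomorph.setCongr spaceKernel_eq_range_base).trans
    isClosedEmbedding_base.isEmbedding.toHomeomorph.symm

/-- After scaling to value `1` at `p`, the modulus is at most `c < 1` on the base copy. For `c < c'
< 1` only finitely many points have modulus at least `c'`, so some `m` in `(c', 1)` is not among
their real parts. -/
theorem exists_idempotent_of_norm_lt [CompactSpace K] [Nonempty K]
    {A : Subalgebra ℂ C(AleksandrovDuplicate K, ℂ)}
    (hA : IsClosed (A : Set C(AleksandrovDuplicate K, ℂ))) {f : C(AleksandrovDuplicate K, ℂ)}
    (hf : f ∈ A) {p : AleksandrovDuplicate K} (h : ∀ x, ‖f (base x)‖ < ‖f p‖) :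
    ∃ g ∈ A, ∃ H : Set (AleksandrovDuplicate K), H.Nonempty ∧ H ≠ univ ∧
      ∀ x, g x = H.indicator (fun _ => (1 : ℂ)) x := by
  obtain ⟨x₀, -, hx₀⟩ := isCompact_univ.exists_isMaxOn (univ_nonempty (α := K))
    (f := fun x => ‖f (base x)‖) ((f.continuous.comp continuous_base).norm.continuousOn)
  have hp0 : 0 < ‖f p‖ := (norm_nonneg _).trans_lt (h x₀)
  have hfp : f p ≠ 0 := norm_pos_iff.1 hp0
  set g := (f p)⁻¹ • f with hg
  have hgq : ∀ q, g q = (f p)⁻¹ * f q := fun q => rfl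
  set c := ‖f (base x₀)‖ / ‖f p‖ with hc
  have hc1 : c < 1 := (div_lt_one hp0).2 (h x₀)
  have hgb : ∀ x, ‖g (base x)‖ ≤ c := fun x => by
    rw [hgq, norm_mul, norm_inv, hc, inv_mul_eq_div]
    exact div_le_div_of_nonneg_right (hx₀ (mem_univ x)) hp0.le
  obtain ⟨c', hcc', hc'1⟩ := exists_between hc1
  have hfin := finite_compl_of_isOpen (W := {q | ‖g q‖ < c'})
    (isOpen_lt g.continuous.norm continuous_const) fun x => (hgb x).trans_lt hcc'
  obtain ⟨m, ⟨hm1, hm2⟩, hm⟩ := ((Ioo_infinite hc'1).sdiff (hfin.image fun q => (g q).re)).nonempty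
  refine Subalgebra.exists_idempotent_of_re_ne hA (A.smul_mem hf (f p)⁻¹) (m := m)
    (p := base x₀) (q := p) (fun q hq => ?_) ?_ ?_
  · by_cases hqW : ‖g q‖ < c'
    · exact absurd (hq ▸ (Complex.re_le_norm (g q)).trans_lt hqW) (not_lt.2 hm1.le)
    · exact hm ⟨q, hqW, hq⟩
  · exact ((Complex.re_le_norm (g (base x₀))).trans_lt ((hgb x₀).trans_lt hcc')).trans hm1
  · rw [← hg, hgq, inv_mul_cancel₀ hfp]
    exact hm2

/-- The difference between `f` and its pullback from the base copy vanishes on that copy, so it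
exceeds each `1 / (n + 1)` at finitely many points only. -/
theorem countable_ne [CompactSpace K] (f : C(AleksandrovDuplicate K, ℂ)) :
    {x | f (twin x) ≠ f (base x)}.Countable := by
  have h : ∀ n : ℕ, {x | (1 : ℝ) / (n + 1) ≤ ‖f (twin x) - f (base x)‖}.Finite := fun n => by
    have hfin := finite_compl_of_isOpen (W := {q | ‖f q - f (base (proj q))‖ < 1 / (n + 1)})
      (isOpen_lt (f.continuous.sub (f.continuous.comp
        (continuous_base.comp continuous_proj))).norm continuous_const) (fun x => by
          change ‖f (base x) - f (base x)‖ < _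
          rw [sub_self, norm_zero]; positivity)
    refine (hfin.image proj).subset fun x hx => ⟨twin x, ?_, rfl⟩
    exact not_lt.2 (show (1 : ℝ) / (n + 1) ≤ ‖f (twin x) - f (base x)‖ from hx)
  refine (countable_iUnion fun n => (h n).countable).mono fun x hx => ?_
  obtain ⟨n, hn⟩ := exists_nat_one_div_lt (norm_pos_iff.2 (sub_ne_zero.2 hx))
  exact mem_iUnion.2 ⟨n, hn.le⟩

theorem hasNTIP [CompactSpace K] [T2Space K] [SecondCountableTopology K] [Uncountable K] :
    HasNTIP (AleksandrovDuplicate K) := by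
  intro A hsep hA
  have hne : Nonempty K := inferInstance
  by_contra hno
  have hle : ∀ f ∈ A, ∀ p, ∃ x, ‖f p‖ ≤ ‖f (base x)‖ := fun f hf p => by
    by_contra! h
    exact hno (exists_idempotent_of_norm_lt hA hf h)
  let R : C(AleksandrovDuplicate K, ℂ) → C(K, ℂ) := fun f => f.comp ⟨base, continuous_base⟩
  -- `C(K, ℂ)` is separable. By `hle`, approximation on the base copy is approximation everywhere,
  -- so the lifts of `D` are dense in `A`.
  obtain ⟨D, hDc, hD⟩ := TopologicalSpace.exists_countable_dense (R '' (A : Set _))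
  choose lift hliftA hlift using fun g : R '' (A : Set _) => g.2
  have hcount : (⋃ g ∈ D, {x | lift g (twin x) ≠ lift g (base x)}).Countable :=
    hDc.biUnion fun g _ => countable_ne _
  obtain ⟨x, hx⟩ : ∃ x, x ∉ ⋃ g ∈ D, {x | lift g (twin x) ≠ lift g (base x)} := by
    by_contra! h
    exact not_countable_univ (hcount.mono fun x _ => h x)
  obtain ⟨_, ⟨f, hf, rfl⟩, hfx⟩ := hsep (twin_ne_base x x)
  have hδ : 0 < ‖f (twin x) - f (base x)‖ / 2 := half_pos (norm_pos_iff.2 (sub_ne_zero.2 hfx))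
  obtain ⟨g, hg, hgd⟩ := hD.exists_dist_lt ⟨R f, f, hf, rfl⟩ hδ
  have hclose : ∀ p, ‖f p - lift g p‖ < ‖f (twin x) - f (base x)‖ / 2 := fun p => by
    obtain ⟨y, hy⟩ := hle _ (A.sub_mem hf (hliftA g)) p
    refine hy.trans_lt (lt_of_le_of_lt ?_ hgd)
    rw [Subtype.dist_eq, ← hlift g]
    exact (dist_eq_norm (R f y) (R (lift g) y)).symm.trans_le (ContinuousMap.dist_apply_le_dist y)
  have heq : lift g (twin x) = lift g (base x) := by
    by_contra h
    exact hx (mem_iUnion₂.2 ⟨g, hg, h⟩)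
  have h1 := hclose (twin x)
  have h2 := hclose (base x)
  have h3 := norm_sub_le (f (twin x) - lift g (twin x)) (f (base x) - lift g (base x))
  rw [heq, sub_sub_sub_cancel_right] at h3
  rw [heq] at h1
  linarith

end AleksandrovDuplicate

/-! ### The double arrow space -/

/-- A bounded linear order with all suprema is compact in its order topology. -/
theorem compactSpace_of_forall_exists_isLUB {α : Type*} [LinearOrder α] [BoundedOrder α]
    [TopologicalSpace α] [OrderTopology α] (h : ∀ s : Set α, ∃ a, IsLUB s a) : CompactSpace α := by
  classical
  choose sup hsup using h
  let : SupSet α := ⟨sup⟩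
  let L : ConditionallyCompleteLattice α :=
    conditionallyCompleteLatticeOfLatticeOfsSup α fun s _ _ => hsup s
  let : ConditionallyCompleteLinearOrder α :=
    { L, (inferInstance : LinearOrder α) with
      csSup_of_not_bddAbove := fun s hs => absurd ⟨⊤, fun _ _ => le_top⟩ hs
      csInf_of_not_bddBelow := fun s hs => absurd ⟨⊥, fun _ _ => bot_le⟩ hs }
  have := ConditionallyCompleteLinearOrder.isCompact_Icc (⊥ : α) ⊤
  rw [Icc_bot_top] at this
  exact ⟨this⟩

namespace DoubleArrow

/-- The underlying element of the lexicographic product. -/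
def toProd (p : DoubleArrow) : ℝ ×ₗ Bool := Subtype.val p

/-- The point of the double arrow space with the given coordinates. -/
def ofProd (x : ℝ) (b : Bool) (h : x ∈ Icc (0 : ℝ) 1 ∧ b = false ∨ x ∈ Ioo (0 : ℝ) 1 ∧ b = true) :
    DoubleArrow := ⟨toLex (x, b), h⟩

/-- The point `(t, 0)`. -/
def lower (t : unitInterval) : DoubleArrow := ofProd t false (Or.inl ⟨t.2, rfl⟩)

/-- The first coordinate. -/
def coord (p : DoubleArrow) : unitInterval :=
  ⟨(ofLex p.toProd).1, Or.elim (Subtype.property p) (fun h => h.1) fun h => Ioo_subset_Icc_self h.1⟩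

open Classical in
/-- The point `(t, 1)` if there is one, and `(t, 0)` otherwise. -/
noncomputable def upper (t : unitInterval) : DoubleArrow :=
  if h : t.1 ∈ Ioo (0 : ℝ) 1 then ofProd t true (Or.inr ⟨h, rfl⟩) else lower t

theorem upper_eq_ofProd {t : unitInterval} (h : t.1 ∈ Ioo (0 : ℝ) 1) :
    upper t = ofProd t true (Or.inr ⟨h, rfl⟩) := dif_pos h

theorem upper_eq_lower {t : unitInterval} (h : t.1 ∉ Ioo (0 : ℝ) 1) : upper t = lower t := dif_neg h

theorem le_iff {p q : DoubleArrow} : p ≤ q ↔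
    coord p < coord q ∨ coord p = coord q ∧ (ofLex p.toProd).2 ≤ (ofLex q.toProd).2 := by
  have : p ≤ q ↔ p.toProd ≤ q.toProd := Iff.rfl
  rw [this, Prod.Lex.le_iff, Subtype.ext_iff, ← Subtype.coe_lt_coe]
  rfl

@[simp]
theorem coord_lower (t : unitInterval) : coord (lower t) = t := rfl

@[simp]
theorem coord_upper (t : unitInterval) : coord (upper t) = t := by
  by_cases h : t.1 ∈ Ioo (0 : ℝ) 1
  · rw [upper_eq_ofProd h]; rfl
  · rw [upper_eq_lower h]; rfl

theorem eq_lower_or_upper (p : DoubleArrow) : p = lower (coord p) ∨ p = upper (coord p) := by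
  obtain ⟨⟨x, b⟩, h | h⟩ := p
  · obtain rfl : b = false := h.2
    exact Or.inl rfl
  · obtain rfl : b = true := h.2
    exact Or.inr (upper_eq_ofProd (t := ⟨x, Ioo_subset_Icc_self h.1⟩) h.1).symm

theorem lower_le_upper (t : unitInterval) : lower t ≤ upper t :=
  le_iff.2 (Or.inr ⟨by simp, Bool.false_le _⟩)

theorem lower_lt_upper {t : unitInterval} (ht : t.1 ∈ Ioo (0 : ℝ) 1) : lower t < upper t := by
  refine lt_of_le_not_ge (lower_le_upper t) fun h => ?_
  rw [le_iff, coord_upper, coord_lower, upper_eq_ofProd ht] at h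
  rcases h with h | ⟨-, h⟩
  · exact lt_irrefl _ h
  · exact absurd h (show ¬ true ≤ false by decide)

theorem monotone_coord : Monotone coord := fun _ _ h =>
  (le_iff.1 h).elim (fun h => h.le) fun h => h.1.le

theorem lt_of_coord_lt {p q : DoubleArrow} (h : coord p < coord q) : p < q :=
  lt_of_not_ge fun h' => not_lt.2 (monotone_coord h') h

theorem le_lower_or_upper_le (p : DoubleArrow) (t : unitInterval) : p ≤ lower t ∨ upper t ≤ p := by
  rcases lt_trichotomy (coord p) t with h | h | h
  · exact Or.inl (lt_of_coord_lt h).le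
  · subst h
    exact (eq_lower_or_upper p).imp (fun h => h.le) fun h => h.ge
  · exact Or.inr (lt_of_coord_lt (by simpa using h)).le

theorem Iic_lower {t : unitInterval} (ht : t.1 ∈ Ioo (0 : ℝ) 1) : Iic (lower t) = Iio (upper t) := by
  ext p
  refine ⟨fun h => lt_of_le_of_lt h (lower_lt_upper ht), fun h => ?_⟩
  exact (le_lower_or_upper_le p t).resolve_right (not_le.2 h)

theorem continuous_coord : Continuous coord :=
  monotone_coord.continuous_of_surjective fun t => ⟨lower t, rfl⟩

instance : BoundedOrder DoubleArrow where
  bot := lower 0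
  bot_le p := le_iff.2 <| (lt_or_eq_of_le (show 0 ≤ coord p from (coord p).2.1)).imp id
    fun h => ⟨h, Bool.false_le _⟩
  top := lower 1
  le_top p := by
    rcases lt_or_eq_of_le (show coord p ≤ 1 from (coord p).2.2) with h | h
    · exact (lt_of_coord_lt h).le
    · rcases eq_lower_or_upper p with hp | hp
      · rw [hp, h]
      · rw [hp, h, upper_eq_lower (by simp)]

/-- The supremum lies over the supremum `c` of the first coordinates; it is the upper point exactly
when that point belongs to `s`, and the lower one otherwise. -/
theorem exists_isLUB (s : Set DoubleArrow) : ∃ a, IsLUB s a := by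
  set c := sSup (coord '' s)
  have hle : ∀ p ∈ s, coord p ≤ c := fun p hp => le_sSup ⟨p, hp, rfl⟩
  have hc : ∀ b ∈ upperBounds s, c ≤ coord b := fun b hb => sSup_le <| by
    rintro _ ⟨p, hp, rfl⟩
    exact monotone_coord (hb hp)
  by_cases hmem : upper c ∈ s
  · refine ⟨upper c, fun p hp => ?_, fun b hb => hb hmem⟩
    rcases (hle p hp).lt_or_eq with h | h
    · exact (lt_of_coord_lt (by simpa using h)).le
    · rcases eq_lower_or_upper p with hp | hp
      · rw [hp, h]; exact lower_le_upper c
      · rw [hp, h]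
  · refine ⟨lower c, fun p hp => ?_, fun b hb => ?_⟩
    · rcases (hle p hp).lt_or_eq with h | h
      · exact (lt_of_coord_lt h).le
      · rcases eq_lower_or_upper p with hp' | hp'
        · rw [hp', h]
        · rw [h] at hp'
          exact absurd (hp' ▸ hp) hmem
    · rcases (hc b hb).lt_or_eq with h | h
      · exact (lt_of_coord_lt (p := lower c) h).le
      · exact le_iff.2 (Or.inr ⟨h, Bool.false_le _⟩)

instance : CompactSpace DoubleArrow := compactSpace_of_forall_exists_isLUB exists_isLUB

instance : TotallySeparatedSpace DoubleArrow := by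
  rw [totallySeparatedSpace_iff_exists_isClopen]
  intro p q hpq
  wlog hlt : p < q generalizing p q
  · obtain ⟨U, hU, hp, hq⟩ := this hpq.symm (lt_of_le_of_ne (not_lt.1 hlt) hpq.symm)
    exact ⟨Uᶜ, hU.compl, hq, by simpa using hp⟩
  -- Cutting between the two points over `t` gives a clopen initial segment.
  suffices h : ∃ t : unitInterval, t.1 ∈ Ioo (0 : ℝ) 1 ∧ p ≤ lower t ∧ upper t ≤ q by
    obtain ⟨t, ht, hp, hq⟩ := h
    refine ⟨Iic (lower t), ⟨isClosed_Iic, Iic_lower ht ▸ isOpen_Iio⟩, hp, fun h => ?_⟩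
    exact absurd ((lower_lt_upper ht).trans_le hq) (not_lt.2 h)
  rcases (monotone_coord hlt.le).lt_or_eq with h | h
  · obtain ⟨t, h1, h2⟩ := exists_between h
    exact ⟨t, ⟨lt_of_le_of_lt (coord p).2.1 h1, lt_of_lt_of_le h2 (coord q).2.2⟩,
      (lt_of_coord_lt h1).le, (lt_of_coord_lt (by simpa using h2)).le⟩
  · rcases le_lower_or_upper_le p (coord p) with hp | hp
    · rcases le_lower_or_upper_le q (coord p) with hq | hq
      · rcases eq_lower_or_upper p with hp' | hp'
        · exact absurd (hq.trans_eq hp'.symm) (not_le.2 hlt)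
        · exact absurd (hq.trans ((lower_le_upper _).trans_eq hp'.symm)) (not_le.2 hlt)
      · refine ⟨coord p, ?_, hp, hq⟩
        by_contra hn
        rcases eq_lower_or_upper q with hq' | hq'
        · rw [hq', ← h] at hlt
          rcases eq_lower_or_upper p with hp' | hp'
          · exact hlt.ne hp'
          · rw [upper_eq_lower hn] at hp'
            exact hlt.ne hp'
        · rw [hq', ← h, upper_eq_lower hn] at hlt
          rcases eq_lower_or_upper p with hp' | hp'
          · exact hlt.ne hp'
          · rw [upper_eq_lower hn] at hp'
            exact hlt.ne hp'
    · rcases eq_lower_or_upper q with hq' | hq'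
      · rw [hq', ← h] at hlt
        exact absurd ((lower_le_upper _).trans hp) (not_le.2 hlt)
      · rw [hq', ← h] at hlt
        exact absurd hp (not_le.2 hlt)

/-! ### Steps and jumps of continuous functions -/

/-- On the part of the double arrow space over `U`, the function `h` is `ε`-close to `a` at the
left of `t ∈ U`, and to `b` at the right. -/
def IsStep (h : DoubleArrow → ℂ) (ε : ℝ) (U : Set unitInterval) (a b : ℂ) (t : unitInterval) :
    Prop :=
  t ∈ U ∧ ∀ p, coord p ∈ U → (p ≤ lower t → ‖h p - a‖ < ε) ∧ (upper t ≤ p → ‖h p - b‖ < ε)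

/-- The conditions define an open set `W` containing the fibre over `t`; since `coord` is a closed
map, `W` contains the preimage of a neighbourhood of `t`. -/
theorem exists_isStep {h : DoubleArrow → ℂ} (hh : Continuous h) {ε : ℝ} {t : unitInterval} {a b : ℂ}
    (ha : ‖h (lower t) - a‖ < ε) (hb : ‖h (upper t) - b‖ < ε) :
    ∃ U ∈ TopologicalSpace.countableBasis unitInterval, IsStep h ε U a b t := by
  set W : Set DoubleArrow :=
    (Ioi (lower t) ∪ {p | ‖h p - a‖ < ε}) ∩ (Iio (upper t) ∪ {p | ‖h p - b‖ < ε})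
  have hW : IsOpen W :=
    (isOpen_Ioi.union (isOpen_lt (by fun_prop) continuous_const)).inter
      (isOpen_Iio.union (isOpen_lt (by fun_prop) continuous_const))
  have hfib : ∀ p, coord p = t → p ∈ W := by
    rintro p rfl
    refine ⟨?_, ?_⟩
    · rcases (lower_le_upper (coord p)).lt_or_eq with hlt | heq
      · rcases eq_lower_or_upper p with hp | hp
        · right; rw [mem_ofPred_eq, hp]; exact ha
        · left; rw [mem_Ioi]; exact hlt.trans_eq hp.symm
      · right
        have hp : p = lower (coord p) := (eq_lower_or_upper p).elim id fun h => h.trans heq.symm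
        rw [mem_ofPred_eq, hp]; exact ha
    · rcases (lower_le_upper (coord p)).lt_or_eq with hlt | heq
      · rcases eq_lower_or_upper p with hp | hp
        · left; rw [mem_Iio]; exact hp.trans_lt hlt
        · right; rw [mem_ofPred_eq, hp]; exact hb
      · right
        have hp : p = upper (coord p) := (eq_lower_or_upper p).elim (fun h => h.trans heq) id
        rw [mem_ofPred_eq, hp]; exact hb
  have hcl : IsClosed (coord '' Wᶜ) := continuous_coord.isClosedMap _ hW.isClosed_compl
  obtain ⟨U, hU, htU, hUW⟩ :=
    (TopologicalSpace.isBasis_countableBasis unitInterval).exists_subset_of_mem_open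
      (show t ∈ (coord '' Wᶜ)ᶜ by rintro ⟨p, hp, hpt⟩; exact hp (hfib p hpt)) hcl.isOpen_compl
  refine ⟨U, hU, htU, fun p hp => ?_⟩
  have hpW : p ∈ W := by
    by_contra hn
    exact hUW hp ⟨p, hn, rfl⟩
  exact ⟨fun hle => hpW.1.resolve_left (not_lt.2 hle), fun hle => hpW.2.resolve_left (not_lt.2 hle)⟩

/-- Near any `s`, the function is within `r / 2` of a constant on each side, so only `s` itself can
carry a jump of size `r`. Compactness finishes. -/
theorem finite_jump {h : DoubleArrow → ℂ} (hh : Continuous h) {r : ℝ} (hr : 0 < r) :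
    {t | r ≤ ‖h (upper t) - h (lower t)‖}.Finite := by
  choose U hU hUs using fun t => exists_isStep hh (ε := r / 2) (t := t)
    (a := h (lower t)) (b := h (upper t)) (by simpa using hr) (by simpa using hr)
  obtain ⟨T, hT⟩ := CompactSpace.elim_nhds_subcover U fun t =>
    (TopologicalSpace.isOpen_of_mem_countableBasis (hU t)).mem_nhds (hUs t).1
  refine T.finite_toSet.subset fun t ht => ?_
  obtain ⟨s, hs, hts⟩ := mem_iUnion₂.1 (show t ∈ ⋃ x ∈ T, U x from hT ▸ mem_univ t)
  suffices hst : t = s from hst ▸ hs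
  by_contra hne
  have h1 := (hUs s).2 (lower t) (by simpa using hts)
  have h2 := (hUs s).2 (upper t) (by simpa using hts)
  refine absurd (show r ≤ ‖h (upper t) - h (lower t)‖ from ht) (not_le.2 ?_)
  rcases lt_or_gt_of_ne hne with hlt | hlt
  · have h3 := h1.1 (lt_of_coord_lt (by simpa using hlt)).le
    have h4 := h2.1 (lt_of_coord_lt (by simpa using hlt)).le
    have h5 := norm_sub_le (h (upper t) - h (lower s)) (h (lower t) - h (lower s))
    rw [sub_sub_sub_cancel_right] at h5
    linarith
  · have h3 := h1.2 (lt_of_coord_lt (by simpa using hlt)).le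
    have h4 := h2.2 (lt_of_coord_lt (by simpa using hlt)).le
    have h5 := norm_sub_le (h (upper t) - h (upper s)) (h (lower t) - h (upper s))
    rw [sub_sub_sub_cancel_right] at h5
    linarith

/-- Two functions with steps over the same set differ, up to a small error, by zero or a jump. -/
theorem IsStep.norm_sub_lt {h h' : DoubleArrow → ℂ} {ε : ℝ} {U : Set unitInterval} {a b : ℂ}
    {t t' : unitInterval} (hs : IsStep h ε U a b t) (hs' : IsStep h' ε U a b t') {p : DoubleArrow}
    (hp : coord p ∈ U) : ‖h p - h' p‖ < 4 * ε ∨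
      ‖h p - h' p - (h (upper t) - h (lower t))‖ < 4 * ε ∨
      ‖h p - h' p + (h (upper t) - h (lower t))‖ < 4 * ε := by
  have ha := (hs.2 (lower t) (by simpa using hs.1)).1 le_rfl
  have hb := (hs.2 (upper t) (by simpa using hs.1)).2 le_rfl
  have hε : 0 < ε := (norm_nonneg _).trans_lt ha
  have key : ∀ u v c : ℂ, ‖u - c‖ < ε → ‖v - c‖ < ε → ‖u - v‖ < 2 * ε := fun u v c h1 h2 => by
    have h3 := norm_sub_le (u - c) (v - c)
    rw [sub_sub_sub_cancel_right] at h3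
    linarith
  -- If `p` is on the same side of `t` and `t'`, the values nearly agree; if it lies between them,
  -- they differ by about `±(b - a)`, and `b - a` is close to the jump of `h` at `t`.
  rcases le_lower_or_upper_le p t with h1 | h1 <;> rcases le_lower_or_upper_le p t' with h2 | h2
  · left
    linarith [key _ _ _ ((hs.2 p hp).1 h1) ((hs'.2 p hp).1 h2)]
  · right; right
    have h3 := key _ _ _ ((hs.2 p hp).1 h1) ha
    have h4 := key _ _ _ hb ((hs'.2 p hp).2 h2)
    have h5 := norm_add_le (h p - h (lower t)) (h (upper t) - h' p)
    rw [show h p - h' p + (h (upper t) - h (lower t)) =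
      h p - h (lower t) + (h (upper t) - h' p) by ring]
    linarith
  · right; left
    have h3 := key _ _ _ ((hs.2 p hp).2 h1) hb
    have h4 := key _ _ _ ha ((hs'.2 p hp).1 h2)
    have h5 := norm_add_le (h p - h (upper t)) (h (lower t) - h' p)
    rw [show h p - h' p - (h (upper t) - h (lower t)) =
      h p - h (upper t) + (h (lower t) - h' p) by ring]
    linarith
  · left
    linarith [key _ _ _ ((hs.2 p hp).2 h1) ((hs'.2 p hp).2 h2)]

end DoubleArrow

/-! ### The sum with a compact metrizable space -/

namespace DoubleArrow

variable {K : Type*} [TopologicalSpace K] [CompactSpace K]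

/-- The data of a step: its domain and its two values, from a dense sequence. -/
abbrev StepData : Type :=
  ↥(TopologicalSpace.countableBasis unitInterval) × ℕ × ℕ

/-- The function `h` has the step `τ`, with jump at `t`. -/
def StepData.Fits (τ : StepData) (h : DoubleArrow → ℂ) (ε : ℝ) (t : unitInterval) : Prop :=
  IsStep h ε τ.1 (TopologicalSpace.denseSeq ℂ τ.2.1) (TopologicalSpace.denseSeq ℂ τ.2.2) t

theorem exists_stepData_fits {h : DoubleArrow → ℂ} (hh : Continuous h) {ε : ℝ} (hε : 0 < ε)
    (t : unitInterval) : ∃ τ : StepData, τ.Fits h ε t := by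
  have hd := TopologicalSpace.denseRange_denseSeq ℂ
  obtain ⟨i, hi⟩ := hd.exists_dist_lt (h (lower t)) hε
  obtain ⟨j, hj⟩ := hd.exists_dist_lt (h (upper t)) hε
  rw [dist_eq_norm] at hi hj
  obtain ⟨U, hU, hs⟩ := exists_isStep hh hi hj
  exact ⟨⟨⟨U, hU⟩, i, j⟩, hs⟩

theorem exists_finset_stepData {h : DoubleArrow → ℂ} (hh : Continuous h) {ε : ℝ} (hε : 0 < ε) :
    ∃ L : Finset StepData, (∀ τ ∈ L, ∃ t, τ.Fits h ε t) ∧ ∀ s : unitInterval, ∃ τ ∈ L, s ∈ τ.1.1 := by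
  classical
  choose τ hτ using exists_stepData_fits hh hε
  obtain ⟨T, hT⟩ := CompactSpace.elim_nhds_subcover (fun t => (τ t).1.1) fun t =>
    (TopologicalSpace.isOpen_of_mem_countableBasis (τ t).1.2).mem_nhds (hτ t).1
  refine ⟨T.image τ, fun σ hσ => ?_, fun s => ?_⟩
  · obtain ⟨t, -, rfl⟩ := Finset.mem_image.1 hσ
    exact ⟨t, hτ t⟩
  obtain ⟨t, ht, hst⟩ := mem_iUnion₂.1 (show s ∈ ⋃ t ∈ T, (τ t).1.1 from hT ▸ mem_univ s)
  exact ⟨τ t, Finset.mem_image_of_mem _ ht, hst⟩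

/-- The countably many data that describe a function on `K ⊕ DoubleArrow` up to a small error and a
change of the points where it jumps. -/
abbrev SumData : Type := StepData × Finset StepData × ℕ

/-- The function `h` is described by `d` up to `ε`, with a distinguished jump at `x`. -/
def SumData.Fits [SecondCountableTopology K] [T2Space K] (d : SumData) (h : C(K ⊕ DoubleArrow, ℂ))
    (ε : ℝ) (x : unitInterval) : Prop :=
  d.1.Fits (fun p => h (Sum.inr p)) ε x ∧
  (∀ τ ∈ d.2.1, ∃ t, τ.Fits (fun p => h (Sum.inr p)) ε t) ∧
  (∀ s : unitInterval, ∃ τ ∈ d.2.1, s ∈ τ.1.1) ∧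
  ∀ k, ‖h (Sum.inl k) - TopologicalSpace.denseSeq C(K, ℂ) d.2.2 k‖ < ε

variable [SecondCountableTopology K] [T2Space K]

theorem exists_sumData_fits (h : C(K ⊕ DoubleArrow, ℂ)) {ε : ℝ} (hε : 0 < ε) (x : unitInterval) :
    ∃ d : SumData, d.Fits h ε x := by
  have hh : Continuous fun p : DoubleArrow => h (Sum.inr p) := h.continuous.comp continuous_inr
  obtain ⟨τ, hτ⟩ := exists_stepData_fits hh hε x
  obtain ⟨L, hL, hL'⟩ := exists_finset_stepData hh hε
  let hK : C(K, ℂ) := ⟨fun k => h (Sum.inl k), h.continuous.comp continuous_inl⟩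
  obtain ⟨i, hi⟩ := (TopologicalSpace.denseRange_denseSeq C(K, ℂ)).exists_dist_lt hK hε
  refine ⟨⟨τ, L, i⟩, hτ, hL, hL', fun k => ?_⟩
  rw [← dist_eq_norm]
  exact (ContinuousMap.dist_apply_le_dist (f := hK) k).trans_lt hi

/-- The difference of two functions with the same data has the real part away from `±m`, if the
jumps of one of them do. -/
theorem SumData.Fits.re_ne {d : SumData} {h h' : C(K ⊕ DoubleArrow, ℂ)} {ε m : ℝ}
    {x y : unitInterval} (hd : d.Fits h ε x) (hd' : d.Fits h' ε y) (hm : 4 * ε < m)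
    (hJ : ∀ t, 4 * ε ≤ |(|(h (Sum.inr (upper t)) - h (Sum.inr (lower t))).re| - m)|)
    (q : K ⊕ DoubleArrow) : |((h - h') q).re| ≠ m := by
  rw [ContinuousMap.sub_apply]
  have hsmall : ∀ z : ℂ, ‖z‖ < 4 * ε → |z.re| ≠ m := fun z hz h => by
    have := Complex.abs_re_le_norm z
    linarith
  rcases q with k | p
  · have h1 := hd.2.2.2 k
    have h2 := hd'.2.2.2 k
    refine hsmall _ ?_
    have h3 := norm_sub_le (h (Sum.inl k) - TopologicalSpace.denseSeq C(K, ℂ) d.2.2 k)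
      (h' (Sum.inl k) - TopologicalSpace.denseSeq C(K, ℂ) d.2.2 k)
    rw [sub_sub_sub_cancel_right] at h3
    linarith [norm_nonneg (h (Sum.inl k) - TopologicalSpace.denseSeq C(K, ℂ) d.2.2 k)]
  · obtain ⟨τ, hτ, hpτ⟩ := hd.2.2.1 (coord p)
    obtain ⟨t, ht⟩ := hd.2.1 τ hτ
    obtain ⟨t', ht'⟩ := hd'.2.1 τ hτ
    have hJt := hJ t
    have hbig : ∀ z w : ℂ, |z.re| = |(h (Sum.inr (upper t)) - h (Sum.inr (lower t))).re| →
        ‖w - z‖ < 4 * ε → |w.re| ≠ m := fun z w hz hzw hw => by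
      have h1 := (Complex.abs_re_le_norm (w - z)).trans_lt hzw
      have h2 := abs_abs_sub_abs_le w.re z.re
      rw [hw, hz, abs_sub_comm] at h2
      rw [Complex.sub_re] at h1
      linarith
    rcases ht.norm_sub_lt ht' hpτ with h1 | h1 | h1
    · exact hsmall _ h1
    · exact hbig _ _ rfl h1
    · refine hbig (-(h (Sum.inr (upper t)) - h (Sum.inr (lower t)))) _ ?_ ?_
      · rw [Complex.neg_re, abs_neg]
      · rwa [sub_neg_eq_add]

/-- If the functions jump from `0` to `1` at different points, their difference takes a value close
to `1` or to `-1`. -/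
theorem SumData.Fits.exists_lt_abs_re {d : SumData} {h h' : C(K ⊕ DoubleArrow, ℂ)} {ε m : ℝ}
    {x y : unitInterval} (hd : d.Fits h ε x) (hd' : d.Fits h' ε y) (hxy : x < y)
    (h0 : h (Sum.inr (lower x)) = 0) (h1 : h (Sum.inr (upper x)) = 1) (hm : m + 2 * ε < 1) :
    m < ((h - h') (Sum.inr (upper x))).re := by
  -- At `upper x` the function `h` is already `1`, while `h'` has not yet jumped and is near the
  -- common left value, itself near `h (lower x) = 0`.
  have hle : upper x ≤ lower y := (lt_of_coord_lt (by simpa using hxy)).le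
  have h2 := (hd.1.2 (lower x) (by simpa using hd.1.1)).1 le_rfl
  have h3 := (hd'.1.2 (upper x) (by simpa using hd.1.1)).1 hle
  simp only [h0] at h2
  set a := TopologicalSpace.denseSeq ℂ d.1.2.1
  rw [ContinuousMap.sub_apply, h1, Complex.sub_re, Complex.one_re]
  have h4 := norm_sub_le (h' (Sum.inr (upper x)) - a) (0 - a)
  rw [sub_sub_sub_cancel_right, sub_zero] at h4
  have h5 := Complex.re_le_norm (h' (Sum.inr (upper x)))
  linarith

/-- The values `0` and the jumps of a function leave a gap below `1`. -/
theorem exists_gap_jump {h : DoubleArrow → ℂ} (hh : Continuous h) :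
    ∃ m δ : ℝ, 0 < δ ∧ δ < m ∧ m + δ < 1 ∧
      ∀ t, δ ≤ |(|(h (upper t) - h (lower t)).re| - m)| := by
  have hfin := finite_jump hh (r := 1 / 2) (by norm_num)
  set S := (fun t => |(h (upper t) - h (lower t)).re|) '' {t | 1 / 2 ≤ ‖h (upper t) - h (lower t)‖}
  have hS : S.Finite := hfin.image _
  -- Only finitely many jumps have norm at least `1 / 2`; `m` avoids their real parts, and the
  -- remaining jumps stay below `1 / 2 < m`.
  obtain ⟨m, ⟨hm1, hm2⟩, hmS⟩ :=
    ((Ioo_infinite (show (1 / 2 : ℝ) < 1 by norm_num)).sdiff hS).nonempty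
  obtain ⟨η, hη, hball⟩ := Metric.isOpen_iff.1 hS.isClosed.isOpen_compl m hmS
  obtain ⟨δ, hδ0, hδ⟩ := exists_between (show 0 < min η (min (m - 1 / 2) (1 - m)) from
    lt_min hη (lt_min (by linarith) (by linarith)))
  have hδ1 := hδ.trans_le (min_le_left _ _)
  have hδ2 := hδ.trans_le ((min_le_right _ _).trans (min_le_left _ _))
  have hδ3 := hδ.trans_le ((min_le_right _ _).trans (min_le_right _ _))
  refine ⟨m, δ, hδ0, by linarith, by linarith, fun t => ?_⟩
  by_cases ht : 1 / 2 ≤ ‖h (upper t) - h (lower t)‖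
  · by_contra! hlt
    exact hball (by rw [Metric.mem_ball, Real.dist_eq]; exact hlt.trans hδ1) ⟨t, ht, rfl⟩
  · have h1 := Complex.abs_re_le_norm (h (upper t) - h (lower t))
    rw [abs_sub_comm]
    exact le_trans (by linarith) (le_abs_self _)

/-- A countable amount of data cannot distinguish all points of an uncountable type, uniformly in
countably many instances. -/
theorem _root_.exists_forall_exists_ne_eq {α : Type*} {β : Type*} [Uncountable α] [Countable β]
    (f : ℕ → α → β) : ∃ x, ∀ n, ∃ y, y ≠ x ∧ f n y = f n x := by
  by_contra! hcon
  -- The points whose value under `f n` is shared by no other point are mapped injectively into a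
  -- countable type.
  have hc : ∀ n, {x | ∀ y, y ≠ x → f n y ≠ f n x}.Countable := fun n =>
    MapsTo.countable_of_injOn (mapsTo_univ (f n) _)
      (fun x hx y _ hxy => by_contra fun hne => hx y (Ne.symm hne) hxy.symm) (countable_univ)
  refine not_countable_univ ((countable_iUnion hc).mono fun x _ => ?_)
  obtain ⟨n, hn⟩ := hcon x
  exact mem_iUnion.2 ⟨n, hn⟩

instance : Uncountable {t : unitInterval // t.1 ∈ Ioo (0 : ℝ) 1} := by
  have : Uncountable (Ioo (0 : ℝ) 1) := by
    rw [← Cardinal.aleph0_lt_mk_iff, Cardinal.mk_Ioo_real one_pos]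
    exact Cardinal.aleph0_lt_continuum
  exact Function.Injective.uncountable
    (f := fun t : Ioo (0 : ℝ) 1 => (⟨⟨t.1, Ioo_subset_Icc_self t.2⟩, t.2⟩ :
      {t : unitInterval // t.1 ∈ Ioo (0 : ℝ) 1}))
    fun s t hst => Subtype.ext (congrArg (fun u => u.1.1) hst)

/-- The difference of two jump functions with the same data satisfies the gap criterion. A point of
`K` supplies a small value, a point between the jumps a large one. -/
theorem hasNTIP_sum [Nonempty K] : HasNTIP (K ⊕ DoubleArrow) := by
  intro A hsep hA
  have hjump : ∀ t : {t : unitInterval // t.1 ∈ Ioo (0 : ℝ) 1}, ∃ h ∈ A,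
      h (Sum.inr (lower t.1)) = 0 ∧ h (Sum.inr (upper t.1)) = 1 := fun t => by
    obtain ⟨_, ⟨g, hg, rfl⟩, hne⟩ := hsep (show (Sum.inr (lower t.1) : K ⊕ DoubleArrow) ≠
      Sum.inr (upper t.1) from fun h => (lower_lt_upper t.2).ne (Sum.inr_injective h))
    have hne' : g (Sum.inr (upper t.1)) - g (Sum.inr (lower t.1)) ≠ 0 := sub_ne_zero.2 hne.symm
    refine ⟨(g (Sum.inr (upper t.1)) - g (Sum.inr (lower t.1)))⁻¹ •
      (g - algebraMap ℂ _ (g (Sum.inr (lower t.1)))),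
      A.smul_mem (A.sub_mem hg (A.algebraMap_mem _)) _, ?_, ?_⟩
    · simp
    · simp [inv_mul_cancel₀ hne']
  choose h hhA hh0 hh1 using hjump
  have hε : ∀ n : ℕ, (0 : ℝ) < 1 / (n + 1) := fun n => by positivity
  choose d hd using fun n t => exists_sumData_fits (h t) (hε n) t.1
  -- The gap, and so the required precision, depends on `h x`. Thus `x` is chosen first, with a
  -- partner `y` available at every precision.
  obtain ⟨x, hx⟩ := exists_forall_exists_ne_eq d
  obtain ⟨m, δ, hδ, hδm, hmδ, hJ⟩ := exists_gap_jump
    (h := fun p => h x (Sum.inr p)) ((h x).continuous.comp continuous_inr)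
  obtain ⟨n, hn⟩ := exists_nat_one_div_lt (show 0 < δ / 4 by positivity)
  obtain ⟨y, hyx, hdy⟩ := hx n
  have hdx := hd n x
  have hdy' := hd n y
  rw [hdy] at hdy'
  have hεn := hε n
  set ε : ℝ := 1 / (n + 1)
  have hm0 : 0 < m := hδ.trans hδm
  have hre := hdx.re_ne hdy' (m := m) (by linarith) fun t => le_trans (by linarith) (hJ t)
  have hk : ∀ k, |((h x - h y) (Sum.inl k)).re| < m := fun k => by
    refine (Complex.abs_re_le_norm _).trans_lt ?_
    have h1 := hdx.2.2.2 k
    have h2 := hdy'.2.2.2 k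
    have h3 := norm_sub_le (h x (Sum.inl k) - TopologicalSpace.denseSeq C(K, ℂ) (d n x).2.2 k)
      (h y (Sum.inl k) - TopologicalSpace.denseSeq C(K, ℂ) (d n x).2.2 k)
    rw [sub_sub_sub_cancel_right] at h3
    rw [ContinuousMap.sub_apply]
    linarith
  obtain ⟨k⟩ := ‹Nonempty K›
  have hmem := A.sub_mem (hhA x) (hhA y)
  -- The order of `x` and `y` decides whether the difference comes close to `1` or to `-1`, hence
  -- whether the omitted value is `m` or `-m`.
  rcases lt_or_gt_of_ne (show y.1 ≠ x.1 from fun h => hyx (Subtype.ext h)) with hlt | hlt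
  · have h1 := hdy'.exists_lt_abs_re hdx hlt (hh0 y) (hh1 y) (m := m) (by linarith)
    refine Subalgebra.exists_idempotent_of_re_ne hA hmem (m := -m)
      (p := Sum.inr (upper y.1)) (q := Sum.inl k) (fun q hq => hre q ?_) ?_ (abs_lt.1 (hk k)).1
    · rw [hq, abs_neg, abs_of_pos hm0]
    · rw [← neg_sub (h y), ContinuousMap.neg_apply, Complex.neg_re]
      linarith
  · exact Subalgebra.exists_idempotent_of_re_ne hA hmem (m := m)
      (p := Sum.inl k) (q := Sum.inr (upper x.1)) (fun q hq => hre q (by rw [hq, abs_of_pos hm0]))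
      (abs_lt.1 (hk k)).2 (hdx.exists_lt_abs_re hdy' hlt (hh0 x) (hh1 x) (by linarith))

end DoubleArrow

end

/-! ### The two examples -/

theorem mainTheorem11 :
    -- existence of the two spaces
    (∃ (X : Type) (_ : TopologicalSpace X),
      CompactSpace X ∧ T2Space X ∧ TotallyDisconnectedSpace X ∧
      HasNTIP X ∧ ¬ HasNTIP (spaceKernel X)) ∧
    (∃ (Y : Type) (_ : TopologicalSpace Y),
      CompactSpace Y ∧ T2Space Y ∧ TotallyDisconnectedSpace Y ∧
      HasNTIP Y ∧ ¬ HasCSWP Y) ∧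
    -- the Aleksandrov duplicate of the Cantor set is an example of both
    (CompactSpace (AleksandrovDuplicate cantorSet) ∧
      T2Space (AleksandrovDuplicate cantorSet) ∧
      TotallyDisconnectedSpace (AleksandrovDuplicate cantorSet) ∧
      HasNTIP (AleksandrovDuplicate cantorSet) ∧
      ¬ HasNTIP (spaceKernel (AleksandrovDuplicate cantorSet)) ∧
      ¬ HasCSWP (AleksandrovDuplicate cantorSet)) ∧
    -- the disjoint sum of the Cantor set and the double arrow space is an example of the second
    (CompactSpace (cantorSet ⊕ DoubleArrow) ∧
      T2Space (cantorSet ⊕ DoubleArrow) ∧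
      TotallyDisconnectedSpace (cantorSet ⊕ DoubleArrow) ∧
      HasNTIP (cantorSet ⊕ DoubleArrow) ∧
      ¬ HasCSWP (cantorSet ⊕ DoubleArrow)) := by
  have hX : CompactSpace (AleksandrovDuplicate cantorSet) ∧
      T2Space (AleksandrovDuplicate cantorSet) ∧
      TotallyDisconnectedSpace (AleksandrovDuplicate cantorSet) ∧
      HasNTIP (AleksandrovDuplicate cantorSet) ∧
      ¬ HasNTIP (spaceKernel (AleksandrovDuplicate cantorSet)) ∧
      ¬ HasCSWP (AleksandrovDuplicate cantorSet) :=
    ⟨inferInstance, inferInstance, inferInstance, AleksandrovDuplicate.hasNTIP,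
      AleksandrovDuplicate.not_hasNTIP_spaceKernel not_hasNTIP_cantorSet,
      not_hasCSWP_of_isClosedEmbedding AleksandrovDuplicate.isClosedEmbedding_base
        not_hasNTIP_cantorSet exists_isClopen_nontrivial_cantorSet⟩
  have hY : CompactSpace (cantorSet ⊕ DoubleArrow) ∧
      T2Space (cantorSet ⊕ DoubleArrow) ∧
      TotallyDisconnectedSpace (cantorSet ⊕ DoubleArrow) ∧
      HasNTIP (cantorSet ⊕ DoubleArrow) ∧
      ¬ HasCSWP (cantorSet ⊕ DoubleArrow) :=
    ⟨inferInstance, inferInstance, inferInstance, DoubleArrow.hasNTIP_sum,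
      not_hasCSWP_of_isClosedEmbedding Topology.IsClosedEmbedding.inl
        not_hasNTIP_cantorSet exists_isClopen_nontrivial_cantorSet⟩
  obtain ⟨h1, h2, h3, h4, h5, h6⟩ := hX
  obtain ⟨k1, k2, k3, k4, k5⟩ := hY
  exact ⟨⟨_, inferInstance, h1, h2, h3, h4, h5⟩, ⟨_, inferInstance, k1, k2, k3, k4, k5⟩,
    ⟨h1, h2, h3, h4, h5, h6⟩, k1, k2, k3, k4, k5⟩
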